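/- Let $d\ge 2$, $1\le l\le d-1$, and read all mode indices cyclically modulo $d$. Let $n_1,\dots,n_d$ and $r_1,\dots,r_d$ be positive integers with $r_kr_{k+1}\le n_k$ for all $k$ (the critical or subcritical case). Let $\mathcal T\in\mathbb R^{n_1\times\dots\times n_d}$ have a tensor ring (TR) decomposition with ranks $[r_1,\dots,r_d]$, $$t_{j_1\cdots j_d}=\operatorname{tr}\bigl(\boldsymbol\Sigma^{(1)}\mathbf G^{(1)}_{j_1}\cdots\boldsymbol\Sigma^{(d)}\mathbf G^{(d)}_{j_d}\bigr),$$ where the cores $\mathcal G^{(k)}\in\mathbb R^{r_k\times n_k\times r_{k+1}}$ have mode-2 slices $\mathbf G^{(k)}_{j}$ and mode-2 fibers of Euclidean norm $1$, and the $\boldsymbol\Sigma^{(k)}\in\mathbb R^{r_k\times r_k}$ are diagonal with positive diagonal. Assume the strong TR incoherence condition with some parameters $\mu_1,\dots,\mu_d>0$: for all $k$ and all $j,j'$, $$\Bigl|\langle \mathbf G^{(k)}_{j},\mathbf G^{(k)}_{j'}\rangle-\tfrac{r_kr_{k+1}}{n_k}1_{j=j'}\Bigr|\le\frac{\mu_k\sqrt{r_kr_{k+1}}}{n_k}.$$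 For a tensor $\mathcal X$ let $\mathbf X_{\{i,l\}}$ be its $i$-shifting $l$-matricization: the matrix whose rows are indexed by $(j_i,\dots,j_{i+l-1})$ and whose columns are indexed by $(j_{i+l},\dots,j_{i-1})$. It has $a_{il}=\prod_{k=i}^{i+l-1}n_k$ rows and $b_{il}=\prod_{k=i+l}^{i-1}n_k$ columns; put $\overline n_{il}=\max\{a_{il},b_{il}\}$ and $\rho_{il}=r_ir_{i+l}$. Let $\mathbf T_{\{i,l\}}=\mathbf U\mathbf S\mathbf V^{\mathsf T}$ be a compact singular value decomposition (orthonormal columns, positive singular values), and let $\mu_{il}$ be the strong incoherence parameter of the singular vectors of $\mathbf T_{\{i,l\}}$, that is, the maximum $\mu_{il}=\max\{\mu'_{1il},\mu'_{2il},\mu''_{il}\}$ of the least constants such that for all $p,p',q,q'$ $$\Bigl|(\mathbf U\mathbf U^{\mathsf T})_{pp'}-\tfrac{\rho_{il}}{a_{il}}1_{p=p'}\Bigr|\le\frac{\mu'_{1il}\sqrt{\rho_{il}}}{a_{il}},\qquad \Bigl|(\mathbf V\mathbf V^{\mathsf T})_{qq'}-\tfrac{\rho_{il}}{b_{il}}1_{q=q'}\Bigr|\le\frac{\mu'_{2il}\sqrt{\rho_{il}}}{b_{il}},\qquad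 \bigl|(\mathbf U\mathbf V^{\mathsf T})_{pq}\bigr|\le\frac{\mu''_{il}\sqrt{\rho_{il}}}{\sqrt{a_{il}b_{il}}}$$ (these do not depend on the choice of the decomposition). Let $w_1,\dots,w_{\lceil d/2\rceil}\ge0$ be weights, not all zero, let $0\le m\le\prod_kn_k$, and let $\Omega$ be uniformly distributed over all sets of $m$ index tuples. Consider $$\min_{\mathcal X}\ \sum_{i=1}^{\lceil d/2\rceil}w_i\|\mathbf X_{\{i,l\}}\|_*\quad\text{subject to}\quad x_{j}=t_{j}\ \text{ for all } j\in\Omega ,\tag{P}$$ where $\|\cdot\|_*$ is the nuclear norm. (1) There is a numerical constant $C>0$, independent of all of the above data, such that if $$m\ \ge\ C\max_{1\le i\le\lceil d/2\rceil}\mu_{il}^2\,\overline n_{il}\,r_ir_{i+l}\ln^6(\overline n_{il}),$$ then $\mathcal T$ is the unique solution of (P) with probability at least $1-\max_{1\le i\le\lceil d/2\rceil}\overline n_{il}^{-3}$. (2) In particular, for every $K>0$ there is a constant $C_K>0$, depending only on $K$, such that if $n_1=\dots=n_d=n$, $r_1=\dots=r_d=r$, $l=\lceil d/2\rceil$ and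 $\mu_{il}\le K\sqrt{\ln(n^{\lceil d/2\rceil})}$ for $1\le i\le\lceil d/2\rceil$, then $$m\ \ge\ C_K\,n^{\lceil d/2\rceil}r^2\ln^7\bigl(n^{\lceil d/2\rceil}\bigr)$$ implies that $\mathcal T$ is the unique solution of (P) with probability at least $1-n^{-3\lceil d/2\rceil}$. -/

import Mathlib

open scoped Matrix

noncomputable section

/-- Real tensors of order `d` and size `n 0 × ⋯ × n (d-1)`. Modes are elements of `Fin d`, so that
`k + 1` and `i + l` are taken cyclically. -/
abbrev RTensor {d : ℕ} (n : Fin d → ℕ) : Type := (∀ k, Fin (n k)) → ℝ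

/-- Tensor ring factors: cores `G k` of size `r k × n k × r (k+1)` whose mode-2 fibers are
normalized, together with the diagonals `σ k` of the (positive) singular value matrices. -/
structure TensorRing {d : ℕ} [NeZero d] (n r : Fin d → ℕ) where
  G : ∀ k : Fin d, Fin (r k) → Fin (n k) → Fin (r (k + 1)) → ℝ
  σ : ∀ k : Fin d, Fin (r k) → ℝ
  fiber_norm : ∀ k s t, ∑ j, G k s j t ^ 2 = 1
  σ_pos : ∀ k s, 0 < σ k s

namespace TensorRing

variable {d : ℕ} [NeZero d] {n r : Fin d → ℕ}

/-- The represented tensor: the entry at `j` is `tr (Σ⁽¹⁾ G⁽¹⁾_{j₁} ⋯ Σ⁽ᵈ⁾ G⁽ᵈ⁾_{j_d})`, written out as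
a sum over all bond indices. -/
def eval (R : TensorRing n r) : RTensor n := fun j =>
  ∑ t : (∀ k, Fin (r k)), ∏ k, R.σ k (t k) * R.G k (t k) (j k) (t (k + 1))

/-- The strong incoherence property of the cores, with parameters `μ`. -/
def StrongIncoherent (R : TensorRing n r) (μ : Fin d → ℝ) : Prop :=
  (∀ k, 0 < μ k) ∧ ∀ (k : Fin d) (j j' : Fin (n k)),
    |(∑ s, ∑ t, R.G k s j t * R.G k s j' t)
        - (if j = j' then (r k * r (k + 1) : ℝ) / n k else 0)|
      ≤ μ k * √(r k * r (k + 1) : ℝ) / n k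

end TensorRing

/-- The ring is subcritical or critical. -/
def SubOrCritical {d : ℕ} [NeZero d] (n r : Fin d → ℕ) : Prop :=
  ∀ k, r k * r (k + 1) ≤ n k

section Unfolding

variable {d : ℕ}

/-- `k` is one of the `l` cyclically consecutive modes `i, i+1, …, i+l-1`. -/
def InArc (i : Fin d) (l : ℕ) (k : Fin d) : Prop := (k - i).val < l

instance (i : Fin d) (l : ℕ) : DecidablePred (InArc i l) :=
  fun k => inferInstanceAs (Decidable ((k - i).val < l))

/-- Row multi-indices `(j_i, …, j_{i+l-1})` of the `i`-shifting `l`-matricization. -/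
abbrev RowIdx (n : Fin d → ℕ) (i : Fin d) (l : ℕ) : Type :=
  ∀ k : {k : Fin d // InArc i l k}, Fin (n k)

/-- Column multi-indices `(j_{i+l}, …, j_{i-1})` of the `i`-shifting `l`-matricization. -/
abbrev ColIdx (n : Fin d → ℕ) (i : Fin d) (l : ℕ) : Type :=
  ∀ k : {k : Fin d // ¬ InArc i l k}, Fin (n k)

/-- The `i`-shifting `l`-matricization of a tensor, with rows and columns labelled by multi-indices
(instead of by their positions in a linear enumeration of the multi-indices). -/
def unfold {n : Fin d → ℕ} (X : RTensor n) (i : Fin d) (l : ℕ) :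
    Matrix (RowIdx n i l) (ColIdx n i l) ℝ :=
  Matrix.of fun a b => X fun k => if h : InArc i l k then a ⟨k, h⟩ else b ⟨k, h⟩

/-- The larger one of the two dimensions of the `i`-shifting `l`-matricization. -/
def nbar (n : Fin d → ℕ) (i : Fin d) (l : ℕ) : ℕ :=
  max (∏ k with InArc i l k, n k) (∏ k with ¬ InArc i l k, n k)

end Unfolding

/-- The nuclear norm: the sum of the singular values. -/
def nuclearNorm {α β : Type} [Fintype α] [DecidableEq α] [Fintype β] [DecidableEq β]
    (M : Matrix α β ℝ) : ℝ :=
  (Matrix.toEuclideanLin M).singularValues.sum fun _ s => s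

/-- A compact singular value decomposition `M = U diag(s) Vᵀ`: `U` and `V` have orthonormal columns,
and all of the listed singular values are positive. -/
structure CompactSVD {α β : Type} [Fintype α] [Fintype β] (M : Matrix α β ℝ) where
  rk : ℕ
  U : Matrix α (Fin rk) ℝ
  s : Fin rk → ℝ
  V : Matrix β (Fin rk) ℝ
  s_pos : ∀ k, 0 < s k
  U_orth : Uᵀ * U = 1
  V_orth : Vᵀ * V = 1
  eq : M = U * Matrix.diagonal s * Vᵀ

namespace CompactSVD

variable {α β : Type} [Fintype α] [DecidableEq α] [Fintype β] [DecidableEq β] {M : Matrix α β ℝ}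

/-- The least `μ` with `|⟨U_a, U_a'⟩ - (ρ / |α|) 1_{a = a'}| ≤ μ √ρ / |α|` for all rows `a`, `a'`. -/
def leftParam (S : CompactSVD M) (ρ : ℝ) : ℝ :=
  ⨆ p : α × α, |(S.U * S.Uᵀ) p.1 p.2 - (if p.1 = p.2 then ρ / Fintype.card α else 0)|
    * Fintype.card α / √ρ

/-- The least `μ` with `|⟨V_b, V_b'⟩ - (ρ / |β|) 1_{b = b'}| ≤ μ √ρ / |β|` for all rows `b`, `b'`. -/
def rightParam (S : CompactSVD M) (ρ : ℝ) : ℝ :=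
  ⨆ p : β × β, |(S.V * S.Vᵀ) p.1 p.2 - (if p.1 = p.2 then ρ / Fintype.card β else 0)|
    * Fintype.card β / √ρ

/-- The least `μ` with `|⟨U_a, V_b⟩| ≤ μ √ρ / √(|α| |β|)` for all rows `a` of `U` and `b` of `V`. -/
def crossParam (S : CompactSVD M) (ρ : ℝ) : ℝ :=
  ⨆ p : α × β, |(S.U * S.Vᵀ) p.1 p.2| * √(Fintype.card α * Fintype.card β : ℝ) / √ρ

/-- The strong incoherence parameter of the singular vectors: the largest of the three. -/
def incoherence (S : CompactSVD M) (ρ : ℝ) : ℝ :=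
  max (max (S.leftParam ρ) (S.rightParam ρ)) (S.crossParam ρ)

end CompactSVD

/-- The first `⌈d/2⌉` modes, over which the nuclear norms are summed. -/
def shifts (d : ℕ) : Finset (Fin d) := {i | i.val < (d + 1) / 2}

theorem shifts_nonempty (d : ℕ) [NeZero d] : (shifts d).Nonempty := by
  have hd : d ≠ 0 := NeZero.ne d
  refine ⟨⟨0, by omega⟩, ?_⟩
  simp only [shifts, Finset.mem_filter, Finset.mem_univ, true_and]
  omega

section Completion

variable {d : ℕ} {n : Fin d → ℕ}

/-- The objective `∑ᵢ wᵢ ‖X_{i,l}‖_*`. -/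
def objective (w : Fin d → ℝ) (l : ℕ) (X : RTensor n) : ℝ :=
  ∑ i ∈ shifts d, w i * nuclearNorm (unfold X i l)

/-- `T` is the unique minimizer of the objective among the tensors that agree with `T` on `Ω`. -/
def IsUniqueSolution (w : Fin d → ℝ) (l : ℕ) (T : RTensor n) (Ω : Finset (∀ k, Fin (n k))) : Prop :=
  ∀ X : RTensor n, (∀ j ∈ Ω, X j = T j) → X ≠ T → objective w l T < objective w l X

open Classical in
/-- The probability that `T` is the unique solution when `Ω` is uniformly distributed over all sets
of `m` index tuples. -/
def recoveryProb (w : Fin d → ℝ) (l m : ℕ) (T : RTensor n) : ℝ :=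
  (((Finset.univ : Finset (∀ k, Fin (n k))).powersetCard m).filter
      (IsUniqueSolution w l T)).card
    / ((Finset.univ : Finset (∀ k, Fin (n k))).powersetCard m).card

/-- The failure bound `max_i n̄_{il}⁻³`. -/
def failureBound [NeZero d] (n : Fin d → ℕ) (l : ℕ) : ℝ :=
  (shifts d).sup' (shifts_nonempty d) fun i => ((nbar n i l : ℝ) ^ 3)⁻¹

end Completion

end

/-! ### The Golden–Thompson inequality for real symmetric matrices -/

section GoldenThompson

open Filter Topology NormedSpace

variable {D : Type*} [Fintype D] [DecidableEq D]

/-! The tensor problem reduces to matrix completion. If, given the entries on `Ω`, each unfolding of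
the tensor is the unique nuclear norm minimizer among the unfoldings of competitors, then every term
of the objective with positive weight strictly increases, so the weighted sum does too. It remains
to prove recovery for one unfolding and to take a union bound over the shifts.

For a matrix `M = U diag(s) Vᵀ` the competitor `M + Δ`, with `Δ = 0` on the samples, is defeated by
a dual certificate: a `y` supported on the samples whose projection to the tangent space at `M` is
nearly `U Vᵀ` and whose orthogonal part has operator norm at most `1/2`; near-isometry of sampling
on the tangent space controls the remaining error (`CompactSVD.nuclearNorm_lt_of_seqGood`). The
certificate comes from the golfing scheme. Starting from `w = U Vᵀ`, each independent batch of
samples gives an unbiased estimate of `w`, whose tangential part is subtracted. A good batch halves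
both the Euclidean norm and the largest entry of the residual, so logarithmically many batches
suffice and the operator norms of the orthogonal parts form a geometric series
(`CompactSVD.exists_certificate`).

Batches are good by a matrix Bernstein inequality for samples with replacement
(`card_not_sum_le_smul_one`), proved by the Ahlswede–Winter Laplace transform method from the
Golden–Thompson inequality. Incoherence bounds the diagonal of the tangent projection and the
entries of `U Vᵀ`, hence the Bernstein parameters. The normalization `ρ` need not be the rank: the
parameter is always at least `1/2` (`CompactSVD.half_le_incoherence`), which lets all error terms be
measured by `μ² ρ n̄`. Failure is a decreasing event in the sample set, so sampling with replacement
is the worse model (`card_bad_mul_le`).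

One unfolding fails with probability at most `n̄⁻⁵`. The number of shifts is not bounded by `n̄`,
since modes of size one are free; but shifts whose arcs agree on the modes of size at least two give
the same nuclear norm, and so there are at most `∏ n k ≤ n̄²` different events. This leaves `n̄⁻³`.
-/

theorem Matrix.trace_mul_pow_comm (X Y : Matrix D D ℝ) (n : ℕ) :
    ((X * Y) ^ n).trace = ((Y * X) ^ n).trace := by
  cases n with
  | zero => simp
  | succ n =>
    have h : SemiconjBy X (Y * X) (X * Y) := (mul_assoc X Y X).symm
    rw [pow_succ, ← mul_assoc, ← (h.pow_right n).eq, mul_assoc, Matrix.trace_mul_comm, mul_assoc,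
      ← pow_succ]

theorem Matrix.trace_transpose_mul_self_eq {A B : Type*} [Fintype A] [Fintype B]
    (X : Matrix A B ℝ) : (Xᵀ * X).trace = ∑ i, ∑ j, X i j ^ 2 := by
  rw [Finset.sum_comm]
  simp [Matrix.trace, Matrix.mul_apply, sq]

/-- Cauchy–Schwarz for the Frobenius product, in the arithmetic–geometric form: a common bound `c`
on both squared norms avoids square roots. -/
theorem Matrix.abs_trace_mul_le {D : Type*} [Fintype D] {X Y : Matrix D D ℝ} {c : ℝ} (hX : (Xᵀ * X).trace ≤ c)
    (hY : (Yᵀ * Y).trace ≤ c) : |(X * Y).trace| ≤ c := by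
  rw [Matrix.trace_transpose_mul_self_eq] at hX hY
  rw [Finset.sum_comm] at hY
  have key : ∀ e : ℝ, e ^ 2 = 1 → e * (X * Y).trace ≤ c := by
    intro e he
    have : e * (X * Y).trace ≤ ∑ i, ∑ j, (X i j ^ 2 + Y j i ^ 2) / 2 := by
      simp only [Matrix.trace, Matrix.diag, Matrix.mul_apply, Finset.mul_sum]
      refine Finset.sum_le_sum fun i _ => Finset.sum_le_sum fun j _ => ?_
      nlinarith [sq_nonneg (e * X i j - Y j i)]
    refine this.trans ?_
    simp only [add_div, Finset.sum_add_distrib, ← Finset.sum_div]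
    linarith
  exact abs_le.2 ⟨by linarith [key (-1) (by norm_num)], by linarith [key 1 (by norm_num)]⟩

/-- The product of the first `2 ^ k` terms of a sequence. -/
def dyadicProd {M : Type*} [Mul M] : ℕ → (ℕ → M) → M
  | 0, A => A 0
  | k + 1, A => dyadicProd k fun i => A (2 * i) * A (2 * i + 1)

theorem dyadicProd_const {M : Type*} [Monoid M] (k : ℕ) (a : M) :
    dyadicProd k (fun _ => a) = a ^ 2 ^ k := by
  induction k generalizing a with
  | zero => simp [dyadicProd]
  | succ k ih => simp only [dyadicProd, ih, pow_succ' 2, pow_mul, sq]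

/-- A Hölder inequality for Schatten norms of dyadic exponent. -/
theorem abs_trace_dyadicProd_le (k : ℕ) (A : ℕ → Matrix D D ℝ) (c : ℝ)
    (h : ∀ i, (((A i)ᵀ * A i) ^ 2 ^ k).trace ≤ c) : |(dyadicProd (k + 1) A).trace| ≤ c := by
  induction k generalizing A with
  | zero =>
    have h0 := h 0
    have h1 := h 1
    simp only [pow_zero, pow_one] at h0 h1
    exact Matrix.abs_trace_mul_le h0 h1
  | succ k ih =>
    -- Neighbours are multiplied in pairs. The induction hypothesis is used twice: for the product
    -- of the pairs, and again to verify its own assumption, since cyclicity turns `tr (((XY)ᵀ XY) ^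
    -- 2 ^ k)` into the trace of an alternating product of `Xᵀ X` and `Y Yᵀ`.
    refine ih (fun i => A (2 * i) * A (2 * i + 1)) fun i => ?_
    set X := A (2 * i) with hX
    set Y := A (2 * i + 1) with hY
    have e1 : ((X * Y)ᵀ * (X * Y)) = Yᵀ * ((Xᵀ * X) * Y) := by
      simp only [Matrix.transpose_mul, mul_assoc]
    have e2 : (((X * Y)ᵀ * (X * Y)) ^ 2 ^ k).trace
        = (dyadicProd (k + 1) fun j : ℕ => if j % 2 = 0 then Xᵀ * X else Y * Yᵀ).trace := by
      rw [e1, Matrix.trace_mul_pow_comm, mul_assoc]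
      have : (fun i : ℕ => (if 2 * i % 2 = 0 then Xᵀ * X else Y * Yᵀ)
          * (if (2 * i + 1) % 2 = 0 then Xᵀ * X else Y * Yᵀ)) = fun _ => (Xᵀ * X) * (Y * Yᵀ) := by
        funext i
        rw [if_pos (by omega), if_neg (by omega)]
      rw [dyadicProd, this, dyadicProd_const]
    rw [e2]
    refine (le_abs_self _).trans (ih _ fun j => ?_)
    split_ifs
    · have := h (2 * i)
      rw [← hX, pow_succ' 2, pow_mul, sq] at this
      simpa only [Matrix.transpose_mul, Matrix.transpose_transpose] using this
    · have := h (2 * i + 1)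
      rw [← hY, Matrix.trace_mul_pow_comm, pow_succ' 2, pow_mul, sq] at this
      simpa only [Matrix.transpose_mul, Matrix.transpose_transpose] using this

/-- Hölder with all factors equal to `XY` moves the transposes inside, cyclicity turns `Y X X Y`
into `X² Y²`, and this has the same form with half the exponent. -/
theorem trace_mul_pow_two_pow_le {X Y : Matrix D D ℝ} (hX : X.IsSymm) (hY : Y.IsSymm) (k : ℕ) :
    ((X * Y) ^ 2 ^ k).trace ≤ (X ^ 2 ^ k * Y ^ 2 ^ k).trace := by
  induction k generalizing X Y with
  | zero => simp
  | succ k ih =>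
    have h := abs_trace_dyadicProd_le k (fun _ => X * Y) _ fun _ => le_rfl
    rw [dyadicProd_const] at h
    refine (le_abs_self _).trans (h.trans ?_)
    rw [Matrix.transpose_mul, hX.eq, hY.eq, mul_assoc, Matrix.trace_mul_pow_comm]
    rw [show X * (X * Y) * Y = X ^ 2 * Y ^ 2 by simp only [sq, mul_assoc]]
    refine (ih (hX.pow 2) (hY.pow 2)).trans_eq ?_
    rw [← pow_mul, ← pow_mul, ← pow_succ']

/-- Telescoping; in the Lie product formula the factor `n + 1` lost here is absorbed by a one-step
error of order `o(1/n)`. -/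
theorem norm_pow_sub_pow_le {R : Type*} [NormedRing R] [NormOneClass R] {x y : R} {c : ℝ}
    (hx : ‖x‖ ≤ c) (hy : ‖y‖ ≤ c) (n : ℕ) :
    ‖x ^ (n + 1) - y ^ (n + 1)‖ ≤ (n + 1) * c ^ n * ‖x - y‖ := by
  have hc : 0 ≤ c := (norm_nonneg x).trans hx
  induction n with
  | zero => simp
  | succ n ih =>
    have e : x ^ (n + 1 + 1) - y ^ (n + 1 + 1)
        = x * (x ^ (n + 1) - y ^ (n + 1)) + (x - y) * y ^ (n + 1) := by
      rw [pow_succ' x, pow_succ' y (n + 1)]; noncomm_ring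
    have hyn : ‖y ^ (n + 1)‖ ≤ c ^ (n + 1) :=
      (norm_pow_le _ _).trans (pow_le_pow_left₀ (norm_nonneg _) hy _)
    calc _ ≤ ‖x‖ * ‖x ^ (n + 1) - y ^ (n + 1)‖ + ‖x - y‖ * ‖y ^ (n + 1)‖ := by
          rw [e]; exact (norm_add_le _ _).trans (add_le_add (norm_mul_le _ _) (norm_mul_le _ _))
      _ ≤ c * ((n + 1) * c ^ n * ‖x - y‖) + ‖x - y‖ * c ^ (n + 1) := by gcongr
      _ = _ := by push_cast; ring

theorem norm_exp_le_exp_norm {R : Type*} [NormedRing R] [NormedAlgebra ℝ R] [NormOneClass R]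
    [CompleteSpace R] (x : R) : ‖exp x‖ ≤ Real.exp ‖x‖ := by
  have hs : Summable fun n : ℕ => (n.factorial : ℝ)⁻¹ * ‖x‖ ^ n := by
    simpa using norm_expSeries_summable' (𝕂 := ℝ) (‖x‖ : ℝ)
  have h2 : Real.exp ‖x‖ = ∑' n : ℕ, (n.factorial : ℝ)⁻¹ * ‖x‖ ^ n := by
    rw [Real.exp_eq_exp_ℝ, exp_eq_tsum ℝ]
    simp
  rw [h2, exp_eq_tsum ℝ]
  refine tsum_of_norm_bounded hs.hasSum fun n => ?_
  rw [norm_smul, Real.norm_of_nonneg (by positivity)]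
  gcongr
  exact norm_pow_le _ _

/-- The Lie product formula. -/
theorem tendsto_exp_mul_exp_pow {R : Type*} [NormedRing R] [NormedAlgebra ℝ R] [NormOneClass R]
    [CompleteSpace R] (A B : R) :
    Tendsto (fun n : ℕ => (exp (((n : ℝ) + 1)⁻¹ • A) * exp (((n : ℝ) + 1)⁻¹ • B)) ^ (n + 1))
      atTop (𝓝 (exp (A + B))) := by
  have hlim : Tendsto (fun n : ℕ => ((n : ℝ) + 1)⁻¹) atTop (𝓝[≠] 0) := by
    refine tendsto_nhdsWithin_iff.2 ⟨?_, Eventually.of_forall fun n => ?_⟩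
    · simpa using tendsto_one_div_add_atTop_nhds_zero_nat (𝕜 := ℝ)
    · simp only [Set.mem_compl_iff, Set.mem_singleton_iff]; positivity
  -- The two one-step propagators agree to first order at `0`, so their difference at `1/(n+1)` is
  -- `o(1/n)`.
  have hder : HasDerivAt
      (fun t : ℝ => exp (t • (A + B)) - exp (t • A) * exp (t • B)) 0 0 := by
    have := (hasDerivAt_exp_smul_const (𝕂 := ℝ) (A + B) 0).sub
      ((hasDerivAt_exp_smul_const (𝕂 := ℝ) A 0).mul (hasDerivAt_exp_smul_const (𝕂 := ℝ) B 0))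
    simpa [exp_zero, Pi.sub_def, Pi.mul_def] using this
  have hslope := (hasDerivAt_iff_tendsto_slope.1 hder).comp hlim
  have hnorm : Tendsto (fun n : ℕ => ((n : ℝ) + 1) * ‖exp (((n : ℝ) + 1)⁻¹ • (A + B))
      - exp (((n : ℝ) + 1)⁻¹ • A) * exp (((n : ℝ) + 1)⁻¹ • B)‖) atTop (𝓝 0) := by
    have := hslope.norm
    rw [norm_zero] at this
    refine this.congr fun n => ?_
    simp only [Function.comp, slope, vsub_eq_sub, sub_zero, zero_smul, exp_zero, mul_one,
      sub_self, norm_smul, inv_inv, Real.norm_eq_abs]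
    rw [abs_of_nonneg (by positivity)]
  have hexp : ∀ n : ℕ, exp (A + B) = exp (((n : ℝ) + 1)⁻¹ • (A + B)) ^ (n + 1) := by
    intro n
    let _ : NormedAlgebra ℚ R := NormedAlgebra.restrictScalars ℚ ℝ R
    rw [← exp_nsmul, ← Nat.cast_smul_eq_nsmul ℝ, smul_smul]
    push_cast
    rw [mul_inv_cancel₀ (by positivity), one_smul]
  have hbd : ∀ (n : ℕ) (X : R) (c : ℝ), ‖X‖ ≤ c →
      ‖exp (((n : ℝ) + 1)⁻¹ • X)‖ ≤ Real.exp (((n : ℝ) + 1)⁻¹ * c) := by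
    intro n X c hX
    refine (norm_exp_le_exp_norm _).trans (Real.exp_le_exp.2 ?_)
    rw [norm_smul, Real.norm_of_nonneg (by positivity)]
    gcongr
  rw [tendsto_iff_norm_sub_tendsto_zero]
  set c := ‖A‖ + ‖B‖ with hc
  have hub : Tendsto (fun n : ℕ => Real.exp c * (((n : ℝ) + 1) * ‖exp (((n : ℝ) + 1)⁻¹ • (A + B))
      - exp (((n : ℝ) + 1)⁻¹ • A) * exp (((n : ℝ) + 1)⁻¹ • B)‖)) atTop (𝓝 0) := by
    simpa using hnorm.const_mul (Real.exp c)
  refine squeeze_zero (fun _ => norm_nonneg _) (fun n => ?_) hub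
  rw [hexp n, norm_sub_rev]
  have h1 : ‖exp (((n : ℝ) + 1)⁻¹ • (A + B))‖ ≤ Real.exp (((n : ℝ) + 1)⁻¹ * c) :=
    hbd n _ _ (norm_add_le _ _)
  have h2 : ‖exp (((n : ℝ) + 1)⁻¹ • A) * exp (((n : ℝ) + 1)⁻¹ • B)‖
      ≤ Real.exp (((n : ℝ) + 1)⁻¹ * c) := by
    rw [hc, mul_add, Real.exp_add]
    exact (norm_mul_le _ _).trans (mul_le_mul (hbd n A _ le_rfl) (hbd n B _ le_rfl)
      (norm_nonneg _) (Real.exp_nonneg _))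
  refine (norm_pow_sub_pow_le h1 h2 n).trans ?_
  have h3 : Real.exp (((n : ℝ) + 1)⁻¹ * c) ^ n ≤ Real.exp c := by
    rw [← Real.exp_nat_mul, Real.exp_le_exp, ← mul_assoc]
    have hc0 : 0 ≤ c := by positivity
    refine mul_le_of_le_one_left hc0 ?_
    rw [← div_eq_mul_inv, div_le_one (by positivity)]
    linarith
  rw [mul_comm ((n : ℝ) + 1), mul_assoc]
  gcongr

/-- The **Golden–Thompson inequality**. -/
theorem Matrix.trace_exp_add_le {A B : Matrix D D ℝ} (hA : A.IsSymm) (hB : B.IsSymm) :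
    (exp (A + B)).trace ≤ (exp A * exp B).trace := by
  cases isEmpty_or_nonempty D
  · simp [Matrix.trace]
  let _ : NormedRing (Matrix D D ℝ) := Matrix.linftyOpNormedRing
  let _ : NormedAlgebra ℝ (Matrix D D ℝ) := Matrix.linftyOpNormedAlgebra
  have _ : NormOneClass (Matrix D D ℝ) := Matrix.linfty_opNormOneClass
  -- The trace inequality is available for dyadic exponents only, so the limit is taken along `n + 1
  -- = 2 ^ k`.
  have hsub : Tendsto (fun k : ℕ => 2 ^ k - 1) atTop atTop :=
    tendsto_atTop_mono (fun k => Nat.le_sub_one_of_lt Nat.lt_two_pow_self) tendsto_id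
  have h := (tendsto_exp_mul_exp_pow A B).comp hsub
  have htr : Continuous fun M : Matrix D D ℝ => M.trace := continuous_id.matrix_trace
  refine le_of_tendsto ((htr.tendsto _).comp h) (Eventually.of_forall fun k => ?_)
  have hpos : 2 ^ k - 1 + 1 = 2 ^ k := Nat.sub_add_cancel Nat.one_le_two_pow
  have hcast : (((2 ^ k - 1 : ℕ) : ℝ) + 1) = ((2 ^ k : ℕ) : ℝ) := by exact_mod_cast hpos
  simp only [Function.comp, hpos, hcast]
  have hexp : ∀ X : Matrix D D ℝ, exp (((2 ^ k : ℕ) : ℝ)⁻¹ • X) ^ 2 ^ k = exp X := by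
    intro X
    rw [← Matrix.exp_nsmul, ← Nat.cast_smul_eq_nsmul ℝ, smul_smul, mul_inv_cancel₀ (by positivity),
      one_smul]
  refine (trace_mul_pow_two_pow_le ((hA.smul _).exp) ((hB.smul _).exp) k).trans_eq ?_
  rw [hexp, hexp]

end GoldenThompson

/-! ### A matrix Bernstein inequality for sampling with replacement -/

section Bernstein

open NormedSpace

variable {D : Type*} [Fintype D] [DecidableEq D]

theorem Matrix.posSemidef_real_iff {D : Type*} [Fintype D] {A : Matrix D D ℝ} :
    A.PosSemidef ↔ A.IsSymm ∧ ∀ x : D → ℝ, 0 ≤ x ⬝ᵥ A *ᵥ x := by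
  rw [Matrix.posSemidef_iff_dotProduct_mulVec]
  simp [Matrix.IsHermitian, Matrix.IsSymm, Matrix.conjTranspose_eq_transpose_of_trivial]

theorem Matrix.IsSymm.spectral {A : Matrix D D ℝ} (hA : A.IsSymm) :
    ∃ (Q : Matrix D D ℝ) (v : D → ℝ),
      Qᵀ * Q = 1 ∧ Q * Qᵀ = 1 ∧ A = Q * Matrix.diagonal v * Qᵀ := by
  have hH : A.IsHermitian := by
    rw [Matrix.IsHermitian, Matrix.conjTranspose_eq_transpose_of_trivial, hA.eq]
  refine ⟨hH.eigenvectorUnitary, hH.eigenvalues, ?_, ?_, ?_⟩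
  · simpa [Matrix.star_eq_conjTranspose, Matrix.conjTranspose_eq_transpose_of_trivial] using
      Unitary.coe_star_mul_self hH.eigenvectorUnitary
  · simpa [Matrix.star_eq_conjTranspose, Matrix.conjTranspose_eq_transpose_of_trivial] using
      Unitary.coe_mul_star_self hH.eigenvectorUnitary
  · have := hH.spectral_theorem
    simpa [Unitary.conjStarAlgAut_apply, Matrix.star_eq_conjTranspose,
      Matrix.conjTranspose_eq_transpose_of_trivial, Function.comp_def] using this

theorem Matrix.exp_conj_diagonal {Q : Matrix D D ℝ} (v : D → ℝ) (hQ : Q * Qᵀ = 1) :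
    exp (Q * Matrix.diagonal v * Qᵀ) = Q * Matrix.diagonal (fun i => Real.exp (v i)) * Qᵀ := by
  have hu : IsUnit Q := IsUnit.of_mul_eq_one _ hQ
  have := Matrix.exp_conj Q (Matrix.diagonal v) hu
  rw [Matrix.inv_eq_right_inv hQ, Matrix.exp_diagonal] at this
  rw [this, Real.exp_eq_exp_ℝ]
  congr 3
  funext i
  exact Pi.coe_exp v i

theorem Matrix.posSemidef_conj_diagonal {Q : Matrix D D ℝ} {v : D → ℝ} (hv : ∀ i, 0 ≤ v i) :
    (Q * Matrix.diagonal v * Qᵀ).PosSemidef := by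
  have := (Matrix.PosSemidef.diagonal (n := D) (d := v) hv).mul_mul_conjTranspose_same Q
  rwa [Matrix.conjTranspose_eq_transpose_of_trivial] at this

theorem Matrix.nonneg_of_posSemidef_conj_diagonal {Q : Matrix D D ℝ} {v : D → ℝ}
    (hQ : Qᵀ * Q = 1) (h : (Q * Matrix.diagonal v * Qᵀ).PosSemidef) (i : D) : 0 ≤ v i := by
  have := h.conjTranspose_mul_mul_same Q
  rw [Matrix.conjTranspose_eq_transpose_of_trivial] at this
  rw [show Qᵀ * (Q * Matrix.diagonal v * Qᵀ) * Q = Qᵀ * Q * Matrix.diagonal v * (Qᵀ * Q) by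
    simp only [Matrix.mul_assoc], hQ, one_mul, mul_one] at this
  exact Matrix.posSemidef_diagonal_iff.1 this i

theorem Matrix.posSemidef_exp {A : Matrix D D ℝ} (hA : A.IsSymm) :
    (exp A).PosSemidef := by
  obtain ⟨Q, v, -, h2, rfl⟩ := hA.spectral
  rw [Matrix.exp_conj_diagonal v h2]
  exact Matrix.posSemidef_conj_diagonal fun i => (Real.exp_pos _).le

theorem Matrix.PosSemidef.trace_mul_nonneg {A B : Matrix D D ℝ} (hA : A.PosSemidef)
    (hB : B.PosSemidef) : 0 ≤ (A * B).trace := by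
  obtain ⟨Q, v, hQ, -, rfl⟩ := (Matrix.posSemidef_real_iff.1 hA).1.spectral
  have hv := Matrix.nonneg_of_posSemidef_conj_diagonal hQ hA
  have hC := hB.conjTranspose_mul_mul_same Q
  rw [Matrix.conjTranspose_eq_transpose_of_trivial] at hC
  rw [Matrix.mul_assoc, Matrix.mul_assoc, Matrix.trace_mul_comm, Matrix.mul_assoc,
    Matrix.trace]
  refine Finset.sum_nonneg fun i _ => ?_
  rw [Matrix.diag_apply, Matrix.diagonal_mul]
  exact mul_nonneg (hv i) hC.diag_nonneg

/-- Diagonalization reduces this to `exp v ≤ 1 + v + v²` for `|v| ≤ 1`. -/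
theorem Matrix.exp_le_one_add_add_sq {A : Matrix D D ℝ} (hA : A.IsSymm)
    (h1 : (1 - A).PosSemidef) (h2 : (1 + A).PosSemidef) :
    (1 + A + A * A - exp A).PosSemidef := by
  obtain ⟨Q, v, hQ1, hQ2, hAQ⟩ := hA.spectral
  have e1 : (1 : Matrix D D ℝ) = Q * Matrix.diagonal (fun _ => 1) * Qᵀ := by
    rw [Matrix.diagonal_one, mul_one, hQ2]
  have e2 : A * A = Q * Matrix.diagonal (fun i => v i * v i) * Qᵀ := by
    rw [hAQ, ← Matrix.diagonal_mul_diagonal, show Q * Matrix.diagonal v * Qᵀ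
      * (Q * Matrix.diagonal v * Qᵀ) = Q * Matrix.diagonal v * (Qᵀ * Q) * Matrix.diagonal v * Qᵀ by
        simp only [Matrix.mul_assoc], hQ1]
    simp only [Matrix.mul_assoc, Matrix.mul_one]
  have e3 : exp A = Q * Matrix.diagonal (fun i => Real.exp (v i)) * Qᵀ := by
    rw [hAQ, Matrix.exp_conj_diagonal v hQ2]
  have a1 : ∀ i, 0 ≤ 1 - v i := by
    refine Matrix.nonneg_of_posSemidef_conj_diagonal (v := fun i => 1 - v i) hQ1 ?_
    rw [← Matrix.diagonal_sub, Matrix.mul_sub, Matrix.sub_mul, ← e1, ← hAQ]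
    exact h1
  have a2 : ∀ i, 0 ≤ 1 + v i := by
    refine Matrix.nonneg_of_posSemidef_conj_diagonal (v := fun i => 1 + v i) hQ1 ?_
    rw [← Matrix.diagonal_add, Matrix.mul_add, Matrix.add_mul, ← e1, ← hAQ]
    exact h2
  have e4 : 1 + A + A * A - exp A
      = Q * Matrix.diagonal (fun i => 1 + v i + v i * v i - Real.exp (v i)) * Qᵀ := by
    rw [← Matrix.diagonal_sub, ← Matrix.diagonal_add, ← Matrix.diagonal_add]
    simp only [Matrix.mul_add, Matrix.add_mul, Matrix.mul_sub, Matrix.sub_mul]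
    rw [← e1, ← e2, ← e3, ← hAQ]
  rw [e4]
  refine Matrix.posSemidef_conj_diagonal fun i => ?_
  have := Real.abs_exp_sub_one_sub_id_le (x := v i) (abs_le.2 ⟨by linarith [a2 i], by linarith [a1 i]⟩)
  nlinarith [le_abs_self (Real.exp (v i) - 1 - v i)]

/-- Some eigenvalue exceeds `t`, and its exponential is one of the positive summands of the trace.
This is the input to Markov's inequality. -/
theorem Matrix.exp_le_trace_exp {A : Matrix D D ℝ} (hA : A.IsSymm) {t : ℝ}
    (h : ¬ (t • (1 : Matrix D D ℝ) - A).PosSemidef) : Real.exp t ≤ (exp A).trace := by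
  obtain ⟨Q, v, hQ1, hQ2, hAQ⟩ := hA.spectral
  have : ∃ i, t < v i := by
    by_contra! hcon
    refine h ?_
    have e : t • (1 : Matrix D D ℝ) - A = Q * Matrix.diagonal (fun i => t - v i) * Qᵀ := by
      rw [← Matrix.diagonal_sub, Matrix.mul_sub, Matrix.sub_mul, ← hAQ, ← Matrix.smul_one_eq_diagonal]
      simp [hQ2]
    rw [e]
    exact Matrix.posSemidef_conj_diagonal fun i => sub_nonneg.2 (hcon i)
  obtain ⟨i, hi⟩ := this
  rw [hAQ, Matrix.exp_conj_diagonal v hQ2, Matrix.trace_mul_comm, ← Matrix.mul_assoc, hQ1, one_mul,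
    Matrix.trace_diagonal]
  exact (Real.exp_le_exp.2 hi.le).trans
    (Finset.single_le_sum (f := fun i => Real.exp (v i)) (fun j _ => (Real.exp_pos _).le)
      (Finset.mem_univ i))

theorem Matrix.IsSymm.sum {ι : Type*} {D : Type*} (s : Finset ι) {X : ι → Matrix D D ℝ}
    (h : ∀ i, (X i).IsSymm) : (∑ i ∈ s, X i).IsSymm := by
  rw [Matrix.IsSymm, Matrix.transpose_sum]
  exact Finset.sum_congr rfl fun i _ => h i

variable {E : Type*} [Fintype E]

theorem Fin.sum_univ_cons {M : Type*} [AddCommMonoid M] (s : ℕ) (f : (Fin (s + 1) → E) → M) :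
    ∑ ω, f ω = ∑ e, ∑ ω : Fin s → E, f (Fin.cons e ω) := by
  rw [← (Fin.consEquiv fun _ : Fin (s + 1) => E).sum_comp, Fintype.sum_prod_type]
  rfl

/-- The Laplace transform bound of Ahlswede and Winter. -/
theorem sum_trace_exp_sum_le {X : E → Matrix D D ℝ} (hX : ∀ e, (X e).IsSymm) {c : ℝ} (hc : 0 ≤ c)
    (h : (c • (1 : Matrix D D ℝ) - ∑ e, exp (X e)).PosSemidef) (s : ℕ) {S : Matrix D D ℝ}
    (hS : S.IsSymm) :
    ∑ ω : Fin s → E, (exp (S + ∑ i, X (ω i))).trace ≤ c ^ s * (exp S).trace := by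
  induction s generalizing S with
  | zero => simp
  | succ s ih =>
    rw [Fin.sum_univ_cons]
    calc _ = ∑ e, ∑ ω : Fin s → E, (exp ((S + X e) + ∑ i, X (ω i))).trace := by
          simp only [Fin.sum_univ_succ, Fin.cons_zero, Fin.cons_succ, add_assoc]
      _ ≤ ∑ e, c ^ s * (exp S * exp (X e)).trace := by
          -- The first sample joins the deterministic part `S`; Golden–Thompson then splits it off
          -- again, so that averaging over it acts linearly on `exp (X e)`.
          refine Finset.sum_le_sum fun e _ => (ih (hS.add (hX e))).trans ?_
          gcongr
          exact Matrix.trace_exp_add_le hS (hX e)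
      _ = c ^ s * (exp S * ∑ e, exp (X e)).trace := by
          rw [Finset.mul_sum, Matrix.trace_sum, Finset.mul_sum]
      _ ≤ c ^ s * (c * (exp S).trace) := by
          gcongr
          have := (Matrix.posSemidef_exp hS).trace_mul_nonneg h
          rw [mul_sub, Matrix.trace_sub, mul_smul_comm, mul_one, Matrix.trace_smul,
            smul_eq_mul] at this
          linarith
      _ = _ := by ring

open Classical in
/-- **Matrix Bernstein inequality**, one-sided, for `s` independent uniform samples. -/
theorem card_not_sum_le_smul_one [Nonempty E] {X : E → Matrix D D ℝ} (hX : ∀ e, (X e).IsSymm)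
    (hsum : ∑ e, X e = 0) {L t : ℝ} (hL : 0 < L) (ht : 0 < t) (ht1 : t ≤ 1)
    (hle : ∀ e, (L • (1 : Matrix D D ℝ) - X e).PosSemidef)
    (hge : ∀ e, (L • (1 : Matrix D D ℝ) + X e).PosSemidef)
    (hvar : ((Fintype.card E * L) • (1 : Matrix D D ℝ) - ∑ e, X e * X e).PosSemidef) (s : ℕ) :
    (({ω : Fin s → E | ¬ ((s * t) • (1 : Matrix D D ℝ) - ∑ i, X (ω i)).PosSemidef} :
        Finset (Fin s → E)).card : ℝ)
      ≤ Fintype.card D * Real.exp (-(s * t ^ 2 / (4 * L))) * Fintype.card E ^ s := by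
  set N : ℝ := (Fintype.card E : ℝ) with hN
  have hNpos : 0 < N := by rw [hN]; exact_mod_cast Fintype.card_pos
  -- The minimizer of the exponent `θ² L - θ t`; since `t ≤ 1`, the matrices `θ X e` stay in the
  -- range where the quadratic bound for `exp` holds.
  set θ : ℝ := t / (2 * L) with hθ
  have hθpos : 0 < θ := by positivity
  have hθL : θ * L ≤ 1 := by
    rw [hθ]; field_simp; linarith
  have hpsd1 : (1 : Matrix D D ℝ).PosSemidef := Matrix.PosSemidef.one
  have hexp : ∀ e, (1 + θ • X e + (θ • X e) * (θ • X e) - exp (θ • X e)).PosSemidef := by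
    intro e
    refine Matrix.exp_le_one_add_add_sq ((hX e).smul θ) ?_ ?_
    · have := ((hle e).smul hθpos.le).add (hpsd1.smul (sub_nonneg.2 hθL))
      convert this using 1
      module
    · have := ((hge e).smul hθpos.le).add (hpsd1.smul (sub_nonneg.2 hθL))
      convert this using 1
      module
  have hmgf : ((N * Real.exp (θ ^ 2 * L)) • (1 : Matrix D D ℝ)
      - ∑ e, exp (θ • X e)).PosSemidef := by
    have h1 := Matrix.posSemidef_sum Finset.univ fun e _ => hexp e
    have h2 := hvar.smul (sq_nonneg θ)
    have h3 : 0 ≤ N * Real.exp (θ ^ 2 * L) - N * (1 + θ ^ 2 * L) := by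
      have := Real.add_one_le_exp (θ ^ 2 * L)
      nlinarith
    convert (h1.add h2).add (hpsd1.smul h3) using 1
    have e1 : ∑ e, (1 + θ • X e + (θ • X e) * (θ • X e) - exp (θ • X e))
        = N • (1 : Matrix D D ℝ) + θ ^ 2 • ∑ e, X e * X e - ∑ e, exp (θ • X e) := by
      rw [Finset.sum_sub_distrib, Finset.sum_add_distrib, Finset.sum_add_distrib,
        ← Finset.smul_sum, hsum, Finset.smul_sum]
      simp [hN, Nat.cast_smul_eq_nsmul, smul_smul, sq]
    rw [e1]
    module
  have hlap := sum_trace_exp_sum_le (fun e => (hX e).smul θ) (by positivity) hmgf s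
    (S := 0) Matrix.isSymm_zero
  have hone : (exp (0 : Matrix D D ℝ)).trace = Fintype.card D := by
    rw [exp_zero, Matrix.trace_one]
  rw [hone] at hlap
  set B : Finset (Fin s → E) :=
    {ω : Fin s → E | ¬ ((s * t) • (1 : Matrix D D ℝ) - ∑ i, X (ω i)).PosSemidef} with hB
  have hsym : ∀ ω : Fin s → E, (∑ i, θ • X (ω i)).IsSymm := fun ω =>
    Matrix.IsSymm.sum _ fun i => (hX (ω i)).smul θ
  have hmarkov : B.card * Real.exp (θ * (s * t))
      ≤ ∑ ω : Fin s → E, (exp (0 + ∑ i, θ • X (ω i))).trace := by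
    calc _ = ∑ ω ∈ B, Real.exp (θ * (s * t)) := by simp
      _ ≤ ∑ ω ∈ B, (exp (0 + ∑ i, θ • X (ω i))).trace := by
          refine Finset.sum_le_sum fun ω hω => ?_
          rw [zero_add]
          refine Matrix.exp_le_trace_exp (hsym ω) fun hcon => ?_
          rw [hB, Finset.mem_filter] at hω
          refine hω.2 ?_
          have := hcon.smul (inv_nonneg.2 hθpos.le)
          rwa [← Finset.smul_sum, mul_smul, ← smul_sub, smul_smul, inv_mul_cancel₀ hθpos.ne',
            one_smul] at this
      _ ≤ _ := Finset.sum_le_univ_sum_of_nonneg fun ω => by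
          rw [zero_add]; exact (Matrix.posSemidef_exp (hsym ω)).trace_nonneg
  have hfin := hmarkov.trans hlap
  have hexps : Real.exp (-(s * t ^ 2 / (4 * L)))
      = Real.exp (θ ^ 2 * L) ^ s * Real.exp (-(θ * (s * t))) := by
    rw [← Real.exp_nat_mul, ← Real.exp_add]
    congr 1
    rw [hθ]; field_simp; ring
  rw [hexps]
  have hcancel : Real.exp (θ * (s * t)) * Real.exp (-(θ * (s * t))) = 1 := by
    rw [← Real.exp_add]; simp
  calc (B.card : ℝ) = B.card * Real.exp (θ * (s * t)) * Real.exp (-(θ * (s * t))) := by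
        rw [mul_assoc, hcancel, mul_one]
    _ ≤ (N * Real.exp (θ ^ 2 * L)) ^ s * Fintype.card D * Real.exp (-(θ * (s * t))) := by
        gcongr
    _ = _ := by rw [mul_pow]; ring

end Bernstein

/-! ### Nuclear norm, duality and invariance under relabelling -/

section Nuclear

set_option linter.unusedSectionVars false

variable {α β : Type} [Fintype α] [DecidableEq α] [Fintype β] [DecidableEq β]

theorem dotProduct_self_nonneg_real {ι : Type*} [Fintype ι] (x : ι → ℝ) : 0 ≤ x ⬝ᵥ x :=
  Finset.sum_nonneg fun i _ => mul_self_nonneg (x i)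

/-- The operator norm of `W` is at most `c`, expressed by its bilinear form. -/
def OpNormLE {α β : Type*} [Fintype α] [Fintype β] (W : Matrix α β ℝ) (c : ℝ) : Prop :=
  ∀ x y, x ⬝ᵥ W *ᵥ y ≤ c * ((x ⬝ᵥ x + y ⬝ᵥ y) / 2)

theorem OpNormLE.add {α β : Type*} [Fintype α] [Fintype β] {W Z : Matrix α β ℝ} {c e : ℝ}
    (hW : OpNormLE W c) (hZ : OpNormLE Z e) : OpNormLE (W + Z) (c + e) := fun x y => by
  rw [Matrix.add_mulVec, dotProduct_add, add_mul]
  exact add_le_add (hW x y) (hZ x y)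

set_option maxHeartbeats 800000 in
/-- The singular value decomposition. -/
theorem exists_compactSVD (M : Matrix α β ℝ) :
    ∃ S : CompactSVD M, ∑ k, S.s k = nuclearNorm M := by
  set f := Matrix.toEuclideanLin M with hf
  have hn : Module.finrank ℝ (EuclideanSpace ℝ β) = Fintype.card β := finrank_euclideanSpace
  set n := Fintype.card β with hndef
  -- Right singular vectors are eigenvectors of `Mᵀ M`; left ones are their normalized images. The
  -- positive singular values are exactly the first `rk`.
  set v := f.isSymmetric_adjoint_comp_self.eigenvectorBasis hn with hv
  set rk := Module.finrank ℝ f.range with hrk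
  have hle : rk ≤ n := hn ▸ f.finrank_range_le
  have hinner : ∀ i j, inner ℝ (f (v i)) (f (v j))
      = if i = j then f.singularValues i ^ 2 else 0 := by
    intro i j
    rw [← LinearMap.adjoint_inner_left, ← LinearMap.comp_apply,
      f.isSymmetric_adjoint_comp_self.apply_eigenvectorBasis hn i, ← hv, real_inner_smul_left,
      f.sq_singularValues_fin hn, orthonormal_iff_ite.1 v.orthonormal]
    simp
  have hzero : ∀ j : Fin n, rk ≤ j → f (v j) = 0 := by
    intro j hj
    rw [← inner_self_eq_zero (𝕜 := ℝ), hinner, if_pos rfl,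
      f.singularValues_eq_zero_iff_le_finrank_range.2 hj]
    simp
  have hpos : ∀ k : Fin rk, 0 < f.singularValues k := fun k =>
    f.singularValues_pos_iff_lt_finrank_range.2 k.2
  let c : Fin rk → Fin n := Fin.castLE hle
  have hM : ∀ a b, M a b = ∑ j, f (v j) a * v j b := by
    intro a b
    have h1 : M a b = f (EuclideanSpace.single b 1) a := by
      simp [hf, Matrix.toLpLin_apply, Matrix.mulVec_single]
    rw [h1, ← v.sum_repr (EuclideanSpace.single b 1), map_sum]
    simp [OrthonormalBasis.repr_apply_apply, EuclideanSpace.inner_single_right, mul_comm]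
  refine ⟨{ rk := rk
            U := Matrix.of fun a k => (f.singularValues k)⁻¹ * f (v (c k)) a
            s := fun k => f.singularValues k
            V := Matrix.of fun b k => v (c k) b
            s_pos := hpos
            U_orth := ?_
            V_orth := ?_
            eq := ?_ }, ?_⟩
  · ext k l
    have := hinner (c k) (c l)
    rw [PiLp.inner_apply] at this
    simp only [Matrix.mul_apply, Matrix.transpose_apply, Matrix.of_apply]
    have e : ∑ x, (f.singularValues k)⁻¹ * f (v (c k)) x * ((f.singularValues l)⁻¹ * f (v (c l)) x)
        = (f.singularValues k)⁻¹ * (f.singularValues l)⁻¹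
          * ∑ x, inner ℝ (f (v (c k)) x) (f (v (c l)) x) := by
      rw [Finset.mul_sum]
      refine Finset.sum_congr rfl fun x _ => ?_
      simp
      ring
    rw [e, this, Matrix.one_apply]
    by_cases hkl : k = l
    · subst hkl
      have := (hpos k).ne'
      simp only [if_true]
      change _ * _ * (f.singularValues k) ^ 2 = 1
      field_simp
    · have : c k ≠ c l := fun h => hkl (Fin.castLE_injective hle h)
      simp [hkl, this]
  · ext k l
    have := orthonormal_iff_ite.1 v.orthonormal (c k) (c l)
    rw [PiLp.inner_apply] at this
    simp only [Matrix.mul_apply, Matrix.transpose_apply, Matrix.of_apply, Matrix.one_apply]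
    simp only [show (k = l) = (c k = c l) from propext (Fin.castLE_injective hle).eq_iff.symm]
    rw [← this]
    exact Finset.sum_congr rfl fun x _ => by simp [mul_comm]
  · ext a b
    rw [hM a b, Matrix.mul_apply]
    simp only [Matrix.mul_diagonal, Matrix.of_apply, Matrix.transpose_apply]
    have e : ∀ k : Fin rk, (f.singularValues k)⁻¹ * f (v (c k)) a * f.singularValues k * v (c k) b
        = f (v (c k)) a * v (c k) b := by
      intro k
      have := (hpos k).ne'
      field_simp
    simp only [e]
    refine Eq.trans ?_
      (Finset.sum_map Finset.univ (Fin.castLEEmb hle) fun j => f (v j) a * v j b)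
    symm
    refine Finset.sum_subset (Finset.subset_univ _) fun j _ hj => ?_
    rw [hzero j ?_]
    · simp
    · by_contra hcon
      refine hj (Finset.mem_map.2 ⟨⟨j, not_le.1 hcon⟩, Finset.mem_univ _, ?_⟩)
      rfl
  · rw [nuclearNorm, Finsupp.sum, LinearMap.support_singularValues]
    exact Fin.sum_univ_eq_sum_range (fun i : ℕ => f.singularValues i) rk

namespace CompactSVD

variable {M : Matrix α β ℝ} (S : CompactSVD M)

theorem trace_eq (W : Matrix α β ℝ) :
    (Wᵀ * M).trace = ∑ k, (fun a => S.U a k) ⬝ᵥ (W *ᵥ fun b => S.V b k) * S.s k := by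
  have e : Wᵀ * M = Wᵀ * S.U * Matrix.diagonal S.s * S.Vᵀ := by
    conv_lhs => rw [S.eq]
    simp only [Matrix.mul_assoc]
  rw [e, Matrix.trace_mul_comm, ← Matrix.mul_assoc, Matrix.trace]
  refine Finset.sum_congr rfl fun k _ => ?_
  rw [Matrix.diag_apply, Matrix.mul_diagonal]
  congr 1
  simp only [Matrix.mul_apply, dotProduct, Matrix.mulVec, Matrix.transpose_apply, Finset.mul_sum]
  rw [Finset.sum_comm]
  exact Finset.sum_congr rfl fun a _ => Finset.sum_congr rfl fun b _ => by ring

theorem trace_le {W : Matrix α β ℝ} (hW : OpNormLE W 1) : (Wᵀ * M).trace ≤ ∑ k, S.s k := by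
  rw [S.trace_eq]
  refine Finset.sum_le_sum fun k _ => ?_
  have hU : (fun a => S.U a k) ⬝ᵥ (fun a => S.U a k) = 1 := by
    have := congrFun (congrFun S.U_orth k) k
    simpa [Matrix.mul_apply, dotProduct] using this
  have hV : (fun a => S.V a k) ⬝ᵥ (fun a => S.V a k) = 1 := by
    have := congrFun (congrFun S.V_orth k) k
    simpa [Matrix.mul_apply, dotProduct] using this
  have := hW (fun a => S.U a k) (fun b => S.V b k)
  rw [hU, hV] at this
  have := S.s_pos k
  nlinarith

theorem trace_UV : ((S.U * S.Vᵀ)ᵀ * M).trace = ∑ k, S.s k := by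
  have e : (S.U * S.Vᵀ)ᵀ * M = S.V * (S.Uᵀ * S.U) * Matrix.diagonal S.s * S.Vᵀ := by
    refine (congrArg ((S.U * S.Vᵀ)ᵀ * ·) S.eq).trans ?_
    simp only [Matrix.transpose_mul, Matrix.transpose_transpose, Matrix.mul_assoc]
  rw [e, S.U_orth, Matrix.mul_one, Matrix.trace_mul_comm, ← Matrix.mul_assoc, S.V_orth,
    Matrix.one_mul, Matrix.trace_diagonal]

/-- The squared length of `x` splits into the parts along and orthogonal to the columns of `U`. -/
theorem dotProduct_split {α κ : Type*} [Fintype α] [DecidableEq α] [Fintype κ] [DecidableEq κ]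
    {U : Matrix α κ ℝ} (hU : Uᵀ * U = 1) (x : α → ℝ) :
    x ⬝ᵥ x = (Uᵀ *ᵥ x) ⬝ᵥ (Uᵀ *ᵥ x) + ((1 - U * Uᵀ) *ᵥ x) ⬝ᵥ ((1 - U * Uᵀ) *ᵥ x) := by
  have h1 : (Uᵀ *ᵥ x) ⬝ᵥ (Uᵀ *ᵥ x) = x ⬝ᵥ ((U * Uᵀ) *ᵥ x) := by
    rw [← Matrix.mulVec_mulVec, Matrix.dotProduct_mulVec x, ← Matrix.mulVec_transpose]
  have h2 : (U * Uᵀ) * (U * Uᵀ) = U * Uᵀ := by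
    rw [show (U * Uᵀ) * (U * Uᵀ) = U * (Uᵀ * U) * Uᵀ by simp only [Matrix.mul_assoc], hU,
      Matrix.mul_one]
  have h3 : (1 - U * Uᵀ)ᵀ * (1 - U * Uᵀ) = 1 - U * Uᵀ := by
    rw [Matrix.transpose_sub, Matrix.transpose_mul, Matrix.transpose_transpose,
      Matrix.transpose_one, sub_mul, mul_sub, mul_sub, h2]
    simp
  have h4 : ((1 - U * Uᵀ) *ᵥ x) ⬝ᵥ ((1 - U * Uᵀ) *ᵥ x) = x ⬝ᵥ ((1 - U * Uᵀ) *ᵥ x) := by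
    conv_rhs => rw [← h3]
    rw [← Matrix.mulVec_mulVec, Matrix.dotProduct_mulVec x, ← Matrix.mulVec_transpose,
      Matrix.transpose_transpose]
  rw [h1, h4, Matrix.sub_mulVec, Matrix.one_mulVec, dotProduct_sub]
  ring

/-- Subgradients of the nuclear norm. -/
theorem opNormLE_UV_add {W : Matrix α β ℝ} (hW : OpNormLE W 1)
    (hperp : (1 - S.U * S.Uᵀ) * W * (1 - S.V * S.Vᵀ) = W) : OpNormLE (S.U * S.Vᵀ + W) 1 := by
  intro x y
  have h1 : x ⬝ᵥ (S.U * S.Vᵀ) *ᵥ y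
      ≤ ((S.Uᵀ *ᵥ x) ⬝ᵥ (S.Uᵀ *ᵥ x) + (S.Vᵀ *ᵥ y) ⬝ᵥ (S.Vᵀ *ᵥ y)) / 2 := by
    rw [← Matrix.mulVec_mulVec, Matrix.dotProduct_mulVec x, ← Matrix.mulVec_transpose]
    generalize S.Uᵀ *ᵥ x = p
    generalize S.Vᵀ *ᵥ y = q
    rw [dotProduct, dotProduct, dotProduct, ← Finset.sum_add_distrib, Finset.sum_div]
    exact Finset.sum_le_sum fun i _ => by nlinarith [sq_nonneg (p i - q i)]
  have h2 : x ⬝ᵥ W *ᵥ y = ((1 - S.U * S.Uᵀ) *ᵥ x) ⬝ᵥ W *ᵥ ((1 - S.V * S.Vᵀ) *ᵥ y) := by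
    conv_lhs => rw [← hperp]
    rw [← Matrix.mulVec_mulVec, ← Matrix.mulVec_mulVec, Matrix.dotProduct_mulVec x,
      ← Matrix.mulVec_transpose]
    congr 2
    simp [Matrix.transpose_sub, Matrix.transpose_mul]
  rw [Matrix.add_mulVec, dotProduct_add, dotProduct_split S.U_orth x, dotProduct_split S.V_orth y,
    h2]
  have := hW ((1 - S.U * S.Uᵀ) *ᵥ x) ((1 - S.V * S.Vᵀ) *ᵥ y)
  linarith

theorem opNormLE_UV : OpNormLE (S.U * S.Vᵀ) 1 := by
  have := S.opNormLE_UV_add (W := 0) (fun x y => ?_) (by simp)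
  · simpa using this
  · rw [Matrix.zero_mulVec, dotProduct_zero]
    have h1 := dotProduct_self_nonneg_real x
    have h2 := dotProduct_self_nonneg_real y
    linarith

/-- For any compact decomposition the sum is the maximum of `tr (Wᵀ M)` over `W` of operator norm at
most one, attained at `U Vᵀ`; this does not depend on the decomposition. -/
theorem sum_s_eq_nuclearNorm : ∑ k, S.s k = nuclearNorm M := by
  obtain ⟨S', h⟩ := exists_compactSVD M
  rw [← h]
  refine le_antisymm ?_ ?_
  · rw [← S.trace_UV]; exact S'.trace_le S.opNormLE_UV
  · rw [← S'.trace_UV]; exact S.trace_le S'.opNormLE_UV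

/-- Relabelling rows and columns. -/
def reindex {α' β' : Type} [Fintype α'] [Fintype β'] (e : α' ≃ α) (f : β' ≃ β) :
    CompactSVD (M.submatrix e f) where
  rk := S.rk
  U := S.U.submatrix e id
  s := S.s
  V := S.V.submatrix f id
  s_pos := S.s_pos
  U_orth := by
    rw [Matrix.transpose_submatrix, Matrix.submatrix_mul_equiv, S.U_orth, Matrix.submatrix_id_id]
  V_orth := by
    rw [Matrix.transpose_submatrix, Matrix.submatrix_mul_equiv, S.V_orth, Matrix.submatrix_id_id]
  eq := by
    conv_lhs => rw [S.eq]
    ext a b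
    simp [Matrix.mul_apply, Matrix.diagonal_apply]

end CompactSVD

theorem trace_le_nuclearNorm {M W : Matrix α β ℝ} (hW : OpNormLE W 1) :
    (Wᵀ * M).trace ≤ nuclearNorm M := by
  obtain ⟨S, h⟩ := exists_compactSVD M
  exact h ▸ S.trace_le hW

theorem nuclearNorm_submatrix {α' β' : Type} [Fintype α'] [DecidableEq α'] [Fintype β']
    [DecidableEq β'] (M : Matrix α β ℝ) (e : α' ≃ α) (f : β' ≃ β) :
    nuclearNorm (M.submatrix e f) = nuclearNorm M := by
  obtain ⟨S, h⟩ := exists_compactSVD M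
  rw [← h, ← (S.reindex e f).sum_s_eq_nuclearNorm]
  rfl

end Nuclear

/-! ### Concentration of sampling operators -/

section Concentration

set_option linter.unusedSectionVars false

variable {D : Type*} [Fintype D] [DecidableEq D] {E : Type*} [Fintype E] [DecidableEq E]

theorem Matrix.dotProduct_mul_self_mulVec {A : Matrix D D ℝ} (hA : A.IsSymm) (x : D → ℝ) :
    x ⬝ᵥ (A * A) *ᵥ x = (A *ᵥ x) ⬝ᵥ (A *ᵥ x) := by
  rw [← Matrix.mulVec_mulVec, Matrix.dotProduct_mulVec x, ← Matrix.mulVec_transpose, hA.eq]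

theorem Matrix.posSemidef_smul_one_sub_iff {A : Matrix D D ℝ} (hA : A.IsSymm) (c : ℝ) :
    (c • (1 : Matrix D D ℝ) - A).PosSemidef ↔ ∀ x, x ⬝ᵥ A *ᵥ x ≤ c * (x ⬝ᵥ x) := by
  have hs : (c • (1 : Matrix D D ℝ) - A).IsSymm := (Matrix.isSymm_one.smul c).sub hA
  rw [Matrix.posSemidef_real_iff, and_iff_right hs]
  refine forall_congr' fun x => ?_
  rw [Matrix.sub_mulVec, Matrix.smul_mulVec, Matrix.one_mulVec, dotProduct_sub, dotProduct_smul,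
    smul_eq_mul, sub_nonneg]

open Classical in
/-- Two-sided **matrix Bernstein inequality** for the deviation of a uniform sample from its mean. -/
theorem card_not_abs_sum_sub_mean_le [Nonempty E] {Y : E → Matrix D D ℝ}
    (hY : ∀ e, (Y e).IsSymm) {L t : ℝ} (hL : 0 < L) (ht : 0 < t) (ht1 : t ≤ 1)
    (hb : ∀ e x, |x ⬝ᵥ Y e *ᵥ x| ≤ L / 2 * (x ⬝ᵥ x))
    (hv : ∀ x, ∑ e, (Y e *ᵥ x) ⬝ᵥ (Y e *ᵥ x) ≤ Fintype.card E * L * (x ⬝ᵥ x)) (s : ℕ) :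
    (({ω : Fin s → E | ¬ ∀ x, |∑ i, x ⬝ᵥ Y (ω i) *ᵥ x
          - s / Fintype.card E * ∑ e, x ⬝ᵥ Y e *ᵥ x| ≤ s * t * (x ⬝ᵥ x)} :
        Finset (Fin s → E)).card : ℝ)
      ≤ 2 * Fintype.card D * Real.exp (-(s * t ^ 2 / (4 * L))) * Fintype.card E ^ s := by
  set N : ℝ := (Fintype.card E : ℝ) with hN
  have hNpos : 0 < N := by rw [hN]; exact_mod_cast Fintype.card_pos
  set Z : Matrix D D ℝ := N⁻¹ • ∑ e, Y e with hZ
  have hZs : Z.IsSymm := (Matrix.IsSymm.sum _ hY).smul _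
  have hXs : ∀ e, (Y e - Z).IsSymm := fun e => (hY e).sub hZs
  have hNZ : ∑ e, Y e = N • Z := by rw [hZ, smul_smul, mul_inv_cancel₀ hNpos.ne', one_smul]
  have hconst : ∑ _e : E, Z = N • Z := by
    rw [Finset.sum_const, Finset.card_univ, ← Nat.cast_smul_eq_nsmul ℝ]
  have hX0 : ∑ e, (Y e - Z) = 0 := by rw [Finset.sum_sub_distrib, hNZ, hconst, sub_self]
  have hqZ : ∀ x, x ⬝ᵥ Z *ᵥ x = N⁻¹ * ∑ e, x ⬝ᵥ Y e *ᵥ x := fun x => by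
    rw [hZ, Matrix.smul_mulVec, dotProduct_smul, smul_eq_mul, Matrix.sum_mulVec, dotProduct_sum]
  have hbZ : ∀ x, |x ⬝ᵥ Z *ᵥ x| ≤ L / 2 * (x ⬝ᵥ x) := fun x => by
    rw [hqZ, abs_mul, abs_of_pos (inv_pos.2 hNpos), inv_mul_le_iff₀ hNpos]
    refine (Finset.abs_sum_le_sum_abs _ _).trans ((Finset.sum_le_sum fun e _ => hb e x).trans_eq ?_)
    rw [Finset.sum_const, Finset.card_univ, nsmul_eq_mul]
  have hbX : ∀ e x, |x ⬝ᵥ (Y e - Z) *ᵥ x| ≤ L * (x ⬝ᵥ x) := fun e x => by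
    rw [Matrix.sub_mulVec, dotProduct_sub]
    refine (abs_sub _ _).trans ?_
    linarith [hb e x, hbZ x]
  -- Centering only lowers the variance, while it at most doubles the uniform bound; hence `L / 2`
  -- in the hypothesis on `Y`.
  have hsq : ∑ e, (Y e - Z) * (Y e - Z) = ∑ e, Y e * Y e - N • (Z * Z) := by
    have : ∀ e, (Y e - Z) * (Y e - Z) = Y e * Y e - Y e * Z - (Z * Y e - Z * Z) := fun e => by
      noncomm_ring
    simp only [this, Finset.sum_sub_distrib, ← Finset.sum_mul, ← Finset.mul_sum, hNZ]
    rw [Finset.sum_const, Finset.card_univ, ← Nat.cast_smul_eq_nsmul ℝ, Matrix.smul_mul N Z Z,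
      Matrix.mul_smul Z N Z]
    abel
  have hsymsq : ∀ {A : Matrix D D ℝ}, A.IsSymm → (A * A).IsSymm := fun {A} hA => by
    rw [Matrix.IsSymm, Matrix.transpose_mul, hA.eq]
  have hvX : ((N * L) • (1 : Matrix D D ℝ) - ∑ e, (Y e - Z) * (Y e - Z)).PosSemidef := by
    rw [Matrix.posSemidef_smul_one_sub_iff (Matrix.IsSymm.sum _ fun e => hsymsq (hXs e))]
    intro x
    rw [hsq, Matrix.sub_mulVec, Matrix.smul_mulVec, dotProduct_sub, dotProduct_smul, smul_eq_mul,
      Matrix.dotProduct_mul_self_mulVec hZs, Matrix.sum_mulVec, dotProduct_sum]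
    simp only [Matrix.dotProduct_mul_self_mulVec (hY _)]
    have := hv x
    have := mul_nonneg hNpos.le (dotProduct_self_nonneg_real (Z *ᵥ x))
    linarith
  have hXneg : ∀ e, (L • (1 : Matrix D D ℝ) - -(Y e - Z)).PosSemidef := fun e => by
    rw [Matrix.posSemidef_smul_one_sub_iff (hXs e).neg]
    intro x
    rw [Matrix.neg_mulVec, dotProduct_neg]
    exact (neg_le_abs _).trans (hbX e x)
  have hXpos : ∀ e, (L • (1 : Matrix D D ℝ) - (Y e - Z)).PosSemidef := fun e => by
    rw [Matrix.posSemidef_smul_one_sub_iff (hXs e)]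
    exact fun x => (le_abs_self _).trans (hbX e x)
  have hup := card_not_sum_le_smul_one hXs hX0 hL ht ht1 hXpos
    (fun e => by simpa only [sub_neg_eq_add] using hXneg e) hvX s
  have hdown := card_not_sum_le_smul_one (X := fun e => -(Y e - Z)) (fun e => (hXs e).neg)
    (by rw [Finset.sum_neg_distrib, hX0, neg_zero]) hL ht ht1 hXneg
    (fun e => by simpa only [sub_eq_add_neg] using hXpos e)
    (by simpa only [neg_mul_neg] using hvX) s
  have hq : ∀ (ω : Fin s → E) x, x ⬝ᵥ (∑ i, (Y (ω i) - Z)) *ᵥ x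
      = ∑ i, x ⬝ᵥ Y (ω i) *ᵥ x - s / N * ∑ e, x ⬝ᵥ Y e *ᵥ x := fun ω x => by
    rw [Matrix.sum_mulVec, dotProduct_sum]
    simp only [Matrix.sub_mulVec, dotProduct_sub, Finset.sum_sub_distrib, hqZ]
    simp only [Finset.sum_const, Finset.card_univ, Fintype.card_fin, nsmul_eq_mul]
    ring
  have hsub : ({ω : Fin s → E | ¬ ∀ x, |∑ i, x ⬝ᵥ Y (ω i) *ᵥ x
          - s / N * ∑ e, x ⬝ᵥ Y e *ᵥ x| ≤ s * t * (x ⬝ᵥ x)} : Finset (Fin s → E))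
      ⊆ ({ω : Fin s → E | ¬ ((s * t) • (1 : Matrix D D ℝ) - ∑ i, (Y (ω i) - Z)).PosSemidef} :
          Finset (Fin s → E))
        ∪ ({ω : Fin s → E | ¬ ((s * t) • (1 : Matrix D D ℝ) - ∑ i, -(Y (ω i) - Z)).PosSemidef} :
          Finset (Fin s → E)) := by
    intro ω hω
    simp only [Finset.mem_union, Finset.mem_filter, Finset.mem_univ, true_and] at hω ⊢
    by_contra! hcon
    refine hω fun x => ?_
    have h1 := (Matrix.posSemidef_smul_one_sub_iff
      (Matrix.IsSymm.sum _ fun i => hXs (ω i)) _).1 hcon.1 x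
    have h2 := (Matrix.posSemidef_smul_one_sub_iff
      (Matrix.IsSymm.sum _ fun i => (hXs (ω i)).neg) _).1 hcon.2 x
    rw [Finset.sum_neg_distrib, Matrix.neg_mulVec, dotProduct_neg, hq] at h2
    rw [hq] at h1
    exact abs_le.2 ⟨by linarith, h1⟩
  have hcard := (Finset.card_le_card hsub).trans (Finset.card_union_le _ _)
  have hcard' := (Nat.cast_le (α := ℝ)).2 hcard
  push_cast at hcard'
  linarith

/-- The rescaled sampling operator: its mean over `ω` is the identity. -/
noncomputable def sampleOp {s : ℕ} (ω : Fin s → E) (w : E → ℝ) : E → ℝ :=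
  ((Fintype.card E : ℝ) / s) • ∑ i, Pi.single (ω i) (w (ω i))

theorem dotProduct_sampleOp {s : ℕ} (ω : Fin s → E) (w x : E → ℝ) :
    x ⬝ᵥ sampleOp ω w = (Fintype.card E : ℝ) / s * ∑ i, x (ω i) * w (ω i) := by
  rw [sampleOp, dotProduct_smul, smul_eq_mul, dotProduct_sum]
  simp

variable {P : Matrix E E ℝ}

theorem sum_sq_apply_of_proj (hPs : P.IsSymm) (hPP : P * P = P) (e : E) :
    ∑ f, P f e ^ 2 = P e e := by
  conv_rhs => rw [← hPP]
  rw [Matrix.mul_apply]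
  exact Finset.sum_congr rfl fun f _ => by rw [hPs.apply, sq]

theorem dotProduct_proj (hPs : P.IsSymm) (hPP : P * P = P) (x : E → ℝ) :
    x ⬝ᵥ P *ᵥ x = (P *ᵥ x) ⬝ᵥ (P *ᵥ x) := by
  rw [← Matrix.dotProduct_mul_self_mulVec hPs, hPP]

theorem dotProduct_proj_le (hPs : P.IsSymm) (hPP : P * P = P) (x : E → ℝ) :
    (P *ᵥ x) ⬝ᵥ (P *ᵥ x) ≤ x ⬝ᵥ x := by
  have h := dotProduct_self_nonneg_real (x - P *ᵥ x)
  rw [sub_dotProduct, dotProduct_sub, dotProduct_sub, dotProduct_comm (P *ᵥ x) x,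
    dotProduct_proj hPs hPP] at h
  linarith

theorem dotProduct_sq_le {ι : Type*} [Fintype ι] (x y : ι → ℝ) :
    (x ⬝ᵥ y) ^ 2 ≤ (x ⬝ᵥ x) * (y ⬝ᵥ y) := by
  have := Finset.sum_mul_sq_le_sq_mul_sq Finset.univ x y
  simpa [dotProduct, sq] using this

open Classical in
/-- Sampling nearly preserves the norms of vectors in the range of an incoherent projection. -/
theorem card_not_sampling_isometry [Nonempty E] (hPs : P.IsSymm) (hPP : P * P = P) {L : ℝ}
    (hL : 0 < L) (hκ : ∀ e, Fintype.card E * P e e ≤ L / 2) {s : ℕ} (hs : 0 < s) :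
    (({ω : Fin s → E | ¬ ∀ x, |(Fintype.card E : ℝ) / s * ∑ i, (P *ᵥ x) (ω i) ^ 2
          - x ⬝ᵥ P *ᵥ x| ≤ 1 / 2 * (x ⬝ᵥ x)} : Finset (Fin s → E)).card : ℝ)
      ≤ 2 * Fintype.card E * Real.exp (-(s / (16 * L))) * Fintype.card E ^ s := by
  set N : ℝ := (Fintype.card E : ℝ) with hN
  have hNpos : 0 < N := by rw [hN]; exact_mod_cast Fintype.card_pos
  have hspos : (0 : ℝ) < s := by exact_mod_cast hs
  have hrow : ∀ e x, P e ⬝ᵥ x = (P *ᵥ x) e := fun e x => rfl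
  -- The operator is an average of the rank-one matrices `N P_e P_eᵀ`, of norm `N P e e`, with mean
  -- `P`.
  have hY : ∀ e x, (N • Matrix.vecMulVec (P e) (P e)) *ᵥ x = (N * (P *ᵥ x) e) • P e := by
    intro e x
    ext f
    simp [Matrix.smul_mulVec, Matrix.vecMulVec_mulVec, hrow, mul_assoc, mul_comm]
  have hq : ∀ e x, x ⬝ᵥ (N • Matrix.vecMulVec (P e) (P e)) *ᵥ x = N * (P *ᵥ x) e ^ 2 := by
    intro e x
    rw [hY, dotProduct_smul, dotProduct_comm, hrow, smul_eq_mul]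
    ring
  have hpe : ∀ e, P e ⬝ᵥ P e = P e e := fun e => by
    rw [← sum_sq_apply_of_proj hPs hPP, dotProduct]
    exact Finset.sum_congr rfl fun f _ => by rw [hPs.apply, sq]
  have hbd : ∀ e x, N * (P *ᵥ x) e ^ 2 ≤ L / 2 * (x ⬝ᵥ x) := fun e x => by
    have h1 := dotProduct_sq_le (P e) x
    rw [hrow, hpe] at h1
    have := hκ e
    have := dotProduct_self_nonneg_real x
    nlinarith
  have key := card_not_abs_sum_sub_mean_le (Y := fun e => N • Matrix.vecMulVec (P e) (P e))
    (L := L) (t := 1 / 2) (fun e => Matrix.IsSymm.smul (by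
      ext f g; simp [Matrix.vecMulVec_apply, mul_comm]) N) hL (by norm_num) (by norm_num)
    (fun e x => by
      rw [hq, abs_of_nonneg (by positivity)]
      exact hbd e x)
    (fun x => by
      have e1 : ∀ e, (N • Matrix.vecMulVec (P e) (P e)) *ᵥ x
          ⬝ᵥ (N • Matrix.vecMulVec (P e) (P e)) *ᵥ x = N * (N * P e e) * (P *ᵥ x) e ^ 2 := by
        intro e
        rw [hY, smul_dotProduct, dotProduct_smul, hpe, smul_eq_mul, smul_eq_mul]
        ring
      simp only [e1]
      have h2 := dotProduct_proj_le hPs hPP x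
      calc _ ≤ ∑ e, N * L * (P *ᵥ x) e ^ 2 := by
            refine Finset.sum_le_sum fun e _ => ?_
            have := hκ e
            gcongr
            linarith
        _ = N * L * ((P *ᵥ x) ⬝ᵥ (P *ᵥ x)) := by
            rw [← Finset.mul_sum, dotProduct]; simp only [sq]
        _ ≤ _ := by gcongr) s
  have hmean : ∀ x, ∑ e, N * (P *ᵥ x) e ^ 2 = N * (x ⬝ᵥ P *ᵥ x) := fun x => by
    rw [dotProduct_proj hPs hPP, ← Finset.mul_sum, dotProduct]
    simp only [sq]
  simp only [hq, hmean] at key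
  refine le_trans (le_of_eq ?_) (key.trans (le_of_eq ?_))
  · congr 3
    ext ω
    simp only [← Finset.mul_sum]
    rw [not_iff_not]
    refine forall_congr' fun x => ?_
    rw [← hN, show N * ∑ i, (P *ᵥ x) (ω i) ^ 2 - s / N * (N * (x ⬝ᵥ P *ᵥ x))
      = s * (N / s * ∑ i, (P *ᵥ x) (ω i) ^ 2 - x ⬝ᵥ P *ᵥ x) by field_simp, abs_mul,
      abs_of_pos hspos, mul_assoc, mul_le_mul_iff_right₀ hspos]
  · congr 3
    ring_nf

open Classical in
/-- Sampling nearly preserves the entries of vectors in the range of an incoherent projection. -/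
theorem card_not_sampling_entries [Nonempty E] (hPs : P.IsSymm) (hPP : P * P = P) {L : ℝ}
    (hL : 0 < L) (hκ : ∀ e, Fintype.card E * P e e ≤ L / 2) {s : ℕ} (hs : 0 < s) {w : E → ℝ}
    (hw : P *ᵥ w = w) :
    (({ω : Fin s → E | ¬ ‖P *ᵥ sampleOp ω w - w‖ ≤ ‖w‖ / 2} : Finset (Fin s → E)).card : ℝ)
      ≤ 2 * Fintype.card E * Real.exp (-(s / (16 * L))) * Fintype.card E ^ s := by
  set N : ℝ := (Fintype.card E : ℝ) with hN
  have hNpos : 0 < N := by rw [hN]; exact_mod_cast Fintype.card_pos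
  have hspos : (0 : ℝ) < s := by exact_mod_cast hs
  rcases eq_or_ne w 0 with rfl | hw0
  · have : ∀ ω : Fin s → E, sampleOp ω (0 : E → ℝ) = 0 := fun ω => by simp [sampleOp]
    simp only [this, Matrix.mulVec_zero, sub_zero, norm_zero, zero_div, le_refl, not_true_eq_false,
      Finset.filter_false, Finset.card_empty, Nat.cast_zero]
    positivity
  have hwn : 0 < ‖w‖ := norm_pos_iff.2 hw0
  have hwe : ∀ e, |w e| ≤ ‖w‖ := fun e => norm_le_pi_norm w e
  set u : E → E → ℝ := fun f e => N * (w e / ‖w‖) * P f e with hu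
  have hwu : ∀ e, (w e / ‖w‖) ^ 2 ≤ 1 := fun e => by
    rw [div_pow, div_le_one (by positivity), sq_le_sq, abs_of_pos hwn]
    exact hwe e
  have hrow : ∀ e f, P e ⬝ᵥ P f = P e f := fun e f => by
    conv_rhs => rw [← hPP]
    rw [Matrix.mul_apply, dotProduct]
    exact Finset.sum_congr rfl fun g _ => by rw [hPs.apply g f]
  have hPef : ∀ e f, |N * P e f| ≤ L / 2 := fun e f => by
    refine abs_le_of_sq_le_sq ?_ (by positivity)
    have h1 := dotProduct_sq_le (P e) (P f)
    rw [hrow, hrow, hrow] at h1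
    have he : 0 ≤ P e e := hrow e e ▸ dotProduct_self_nonneg_real (P e)
    calc (N * P e f) ^ 2 ≤ (N * P e e) * (N * P f f) := by nlinarith [sq_nonneg N]
      _ ≤ (L / 2) * (L / 2) := by
          have hf : 0 ≤ P f f := hrow f f ▸ dotProduct_self_nonneg_real (P f)
          exact mul_le_mul (hκ e) (hκ f) (by positivity) (by positivity)
      _ = _ := by ring
  have hYx : ∀ (c : ℝ) (x : Unit → ℝ),
      (Matrix.of fun _ _ => c : Matrix Unit Unit ℝ) *ᵥ x = fun _ => c * x () := by
    intro c x
    ext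
    simp [Matrix.mulVec, dotProduct]
  have hdot : ∀ x y : Unit → ℝ, x ⬝ᵥ y = x () * y () := fun x y => by simp [dotProduct]
  -- For a fixed entry `f` this is scalar Bernstein, read as the `1 × 1` case; a union bound over
  -- the entries follows.
  have key := fun f => card_not_abs_sum_sub_mean_le (D := Unit)
    (Y := fun e => Matrix.of fun _ _ => u f e) (L := L) (t := 1 / 2)
    (fun e => by ext; simp) hL (by norm_num) (by norm_num)
    (fun e x => by
      rw [hYx, hdot, hdot, show x () * (u f e * x ()) = u f e * (x () * x ()) by ring, abs_mul,
        abs_mul_self]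
      refine mul_le_mul_of_nonneg_right ?_ (mul_self_nonneg _)
      rw [show u f e = (w e / ‖w‖) * (N * P f e) by simp only [hu]; ring, abs_mul]
      exact (mul_le_mul (sq_le_one_iff_abs_le_one _ |>.1 (hwu e)) (hPef f e) (abs_nonneg _)
        zero_le_one).trans_eq (one_mul _))
    (fun x => by
      simp only [hYx, hdot]
      calc _ ≤ ∑ e, N ^ 2 * P e f ^ 2 * (x () * x ()) := by
            refine Finset.sum_le_sum fun e _ => ?_
            rw [show u f e * x () * (u f e * x ())
              = N ^ 2 * P e f ^ 2 * (x () * x ()) * (w e / ‖w‖) ^ 2 by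
                simp only [hu, hPs.apply e f]; ring]
            refine mul_le_of_le_one_right ?_ (hwu e)
            have := mul_self_nonneg (x ())
            positivity
        _ = N * (N * P f f) * (x () * x ()) := by
            rw [← Finset.sum_mul, ← Finset.mul_sum, sum_sq_apply_of_proj hPs hPP]; ring
        _ ≤ _ := by
            have := hκ f
            have := mul_self_nonneg (x ())
            gcongr
            linarith) s
  have hmean : ∀ f, ∑ e, u f e = N * (w f / ‖w‖) := fun f => by
    have : ∑ e, P f e * w e = w f := congrFun hw f
    rw [← this, Finset.sum_div, Finset.mul_sum]
    exact Finset.sum_congr rfl fun e _ => by simp only [hu]; ring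
  have hsub : ({ω : Fin s → E | ¬ ‖P *ᵥ sampleOp ω w - w‖ ≤ ‖w‖ / 2} : Finset (Fin s → E))
      ⊆ Finset.univ.biUnion fun f => ({ω : Fin s → E | ¬ ∀ x,
          |∑ i, x ⬝ᵥ (Matrix.of fun _ _ => u f (ω i) : Matrix Unit Unit ℝ) *ᵥ x
          - s / N * ∑ e, x ⬝ᵥ (Matrix.of fun _ _ => u f e : Matrix Unit Unit ℝ) *ᵥ x|
          ≤ s * (1 / 2) * (x ⬝ᵥ x)} : Finset (Fin s → E)) := by
    intro ω hω
    simp only [Finset.mem_biUnion, Finset.mem_filter, Finset.mem_univ, true_and] at hω ⊢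
    by_contra! hcon
    refine hω ((pi_norm_le_iff_of_nonneg (by positivity)).2 fun f => ?_)
    have h := hcon f fun _ => 1
    simp only [hYx, hdot, mul_one, one_mul, hmean] at h
    have e1 : (P *ᵥ sampleOp ω w - w) f
        = ‖w‖ / s * (∑ i, u f (ω i) - s / N * (N * (w f / ‖w‖))) := by
      rw [Pi.sub_apply, Matrix.mulVec, dotProduct_sampleOp, mul_sub]
      congr 1
      · rw [Finset.mul_sum, Finset.mul_sum]
        refine Finset.sum_congr rfl fun i _ => ?_
        simp only [hu]
        field_simp
        rw [hN]
        ring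
      · field_simp
    rw [e1, Real.norm_eq_abs, abs_mul, abs_of_pos (by positivity)]
    calc _ ≤ ‖w‖ / s * (s * (1 / 2)) := by gcongr
      _ = _ := by field_simp
  refine (Nat.cast_le.2 ((Finset.card_le_card hsub).trans Finset.card_biUnion_le)).trans ?_
  rw [Nat.cast_sum]
  refine (Finset.sum_le_sum fun f _ => key f).trans (le_of_eq ?_)
  rw [Finset.sum_const, Finset.card_univ, nsmul_eq_mul, ← hN, Fintype.card_unit,
    show (s : ℝ) * (1 / 2) ^ 2 / (4 * L) = s / (16 * L) by ring]
  push_cast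
  ring

/-- The matrix with a given vector of entries. -/
def matOf {α β : Type*} (w : α × β → ℝ) : Matrix α β ℝ := Matrix.of fun a b => w (a, b)

theorem dotProduct_matOf_mulVec {α β : Type*} [Fintype α] [Fintype β] (w : α × β → ℝ) (x : α → ℝ)
    (y : β → ℝ) : x ⬝ᵥ matOf w *ᵥ y = (fun e => x e.1 * y e.2) ⬝ᵥ w := by
  simp only [dotProduct, Matrix.mulVec, matOf, Matrix.of_apply, Finset.mul_sum,
    Fintype.sum_prod_type]
  exact Finset.sum_congr rfl fun a _ => Finset.sum_congr rfl fun b _ => by ring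

open Classical in
/-- Sampling nearly preserves a matrix with small entries in operator norm. -/
theorem card_not_sampling_opNorm {α β : Type*} [Fintype α] [DecidableEq α] [Fintype β]
    [DecidableEq β] [Nonempty (α × β)] {L b : ℝ} (hL : 0 < L) (hb : 0 < b)
    (h1 : Fintype.card (α × β) * b ≤ L / 2)
    (hα : Fintype.card α * (Fintype.card (α × β) * b ^ 2) ≤ L)
    (hβ : Fintype.card β * (Fintype.card (α × β) * b ^ 2) ≤ L) {s : ℕ} (hs : 0 < s)
    (w : α × β → ℝ) :
    (({ω : Fin s → α × β | ¬ OpNormLE (matOf (sampleOp ω w - w)) (‖w‖ / (4 * b))} :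
        Finset (Fin s → α × β)).card : ℝ)
      ≤ 2 * (Fintype.card α + Fintype.card β) * Real.exp (-(s / (64 * L)))
        * Fintype.card (α × β) ^ s := by
  set N : ℝ := (Fintype.card (α × β) : ℝ) with hN
  have hNpos : 0 < N := by rw [hN]; exact_mod_cast Fintype.card_pos
  have hspos : (0 : ℝ) < s := by exact_mod_cast hs
  rcases eq_or_ne w 0 with rfl | hw0
  · have : ∀ ω : Fin s → α × β, OpNormLE (matOf (sampleOp ω 0 - (0 : α × β → ℝ)))
        (‖(0 : α × β → ℝ)‖ / (4 * b)) := fun ω x y => by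
      rw [dotProduct_matOf_mulVec]
      simp [sampleOp]
    simp only [this, not_true_eq_false, Finset.filter_false, Finset.card_empty, Nat.cast_zero]
    positivity
  have hwn : 0 < ‖w‖ := norm_pos_iff.2 hw0
  -- Scaled so that `|c e| ≤ N b` for every `w`; the deviation `1/4` then corresponds to `‖w‖ / (4
  -- b)`.
  set c : α × β → ℝ := fun e => N * b * (w e / ‖w‖) with hc
  have hwu : ∀ e, |w e / ‖w‖| ≤ 1 := fun e => by
    rw [abs_div, abs_of_pos hwn, div_le_one hwn]
    exact norm_le_pi_norm w e
  have hcabs : ∀ e, |c e| ≤ N * b := fun e => by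
    rw [abs_mul, abs_of_pos (by positivity)]
    exact mul_le_of_le_one_right (by positivity) (hwu e)
  have hcsq : ∀ e, c e ^ 2 ≤ (N * b) ^ 2 := fun e =>
    sq_le_sq.2 ((hcabs e).trans (le_abs_self _))
  -- The symmetric dilation of a single entry, which makes Bernstein for symmetric matrices
  -- applicable to rectangular ones.
  set Y : α × β → Matrix (α ⊕ β) (α ⊕ β) ℝ := fun e =>
    Matrix.fromBlocks 0 (Matrix.single e.1 e.2 (c e)) (Matrix.single e.2 e.1 (c e)) 0 with hY
  have hYz : ∀ e (z : α ⊕ β → ℝ), Y e *ᵥ z = Sum.elim (Pi.single e.1 (c e * z (Sum.inr e.2)))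
      (Pi.single e.2 (c e * z (Sum.inl e.1))) := by
    intro e z
    rw [hY, Matrix.fromBlocks_mulVec]
    simp only [Matrix.zero_mulVec, zero_add, add_zero]
    congr 1
    · ext a
      simp [Matrix.mulVec, dotProduct, Matrix.single_apply, Pi.single_apply, ite_and, eq_comm]
    · ext a
      simp [Matrix.mulVec, dotProduct, Matrix.single_apply, Pi.single_apply, ite_and, eq_comm]
  have hdot : ∀ z z' : α ⊕ β → ℝ, z ⬝ᵥ z'
      = (z ∘ Sum.inl) ⬝ᵥ (z' ∘ Sum.inl) + (z ∘ Sum.inr) ⬝ᵥ (z' ∘ Sum.inr) := fun z z' => by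
    simp [dotProduct, Fintype.sum_sum_type]
  have hq : ∀ e z, z ⬝ᵥ Y e *ᵥ z = 2 * c e * (z (Sum.inl e.1) * z (Sum.inr e.2)) := by
    intro e z
    rw [hYz, hdot]
    simp [Sum.elim_comp_inl, Sum.elim_comp_inr]
    ring
  have hsq : ∀ e z, (Y e *ᵥ z) ⬝ᵥ (Y e *ᵥ z)
      = c e ^ 2 * (z (Sum.inl e.1) ^ 2 + z (Sum.inr e.2) ^ 2) := by
    intro e z
    rw [hYz, hdot]
    simp [Sum.elim_comp_inl, Sum.elim_comp_inr]
    ring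
  have hzz : ∀ z : α ⊕ β → ℝ, z ⬝ᵥ z = ∑ a, z (Sum.inl a) ^ 2 + ∑ b, z (Sum.inr b) ^ 2 :=
    fun z => by simp [dotProduct, Fintype.sum_sum_type, sq]
  have key := card_not_abs_sum_sub_mean_le (Y := Y) (L := L) (t := 1 / 4)
    (fun e => by
      rw [hY, Matrix.IsSymm, Matrix.fromBlocks_transpose]
      simp [Matrix.transpose_single]) hL (by norm_num) (by norm_num)
    (fun e z => by
      have h2 : z (Sum.inl e.1) ^ 2 + z (Sum.inr e.2) ^ 2 ≤ z ⬝ᵥ z := by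
        rw [hzz]
        exact add_le_add
          (Finset.single_le_sum (f := fun a => z (Sum.inl a) ^ 2) (fun _ _ => sq_nonneg _)
            (Finset.mem_univ _))
          (Finset.single_le_sum (f := fun b => z (Sum.inr b) ^ 2) (fun _ _ => sq_nonneg _)
            (Finset.mem_univ _))
      have h3 : |2 * (z (Sum.inl e.1) * z (Sum.inr e.2))| ≤ z ⬝ᵥ z := by
        refine abs_le.2 ⟨?_, ?_⟩
        · nlinarith [sq_nonneg (z (Sum.inl e.1) + z (Sum.inr e.2))]
        · nlinarith [sq_nonneg (z (Sum.inl e.1) - z (Sum.inr e.2))]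
      rw [hq, show 2 * c e * (z (Sum.inl e.1) * z (Sum.inr e.2))
        = c e * (2 * (z (Sum.inl e.1) * z (Sum.inr e.2))) by ring, abs_mul]
      exact mul_le_mul ((hcabs e).trans h1) h3 (abs_nonneg _) (by positivity))
    (fun z => by
      simp only [hsq]
      calc _ ≤ ∑ e : α × β, (N * b) ^ 2 * (z (Sum.inl e.1) ^ 2 + z (Sum.inr e.2) ^ 2) :=
            Finset.sum_le_sum fun e _ => mul_le_mul_of_nonneg_right (hcsq e) (by positivity)
        _ = N * (Fintype.card β * (N * b ^ 2)) * ∑ a, z (Sum.inl a) ^ 2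
            + N * (Fintype.card α * (N * b ^ 2)) * ∑ b, z (Sum.inr b) ^ 2 := by
            rw [← Finset.mul_sum, Fintype.sum_prod_type]
            simp only [Finset.sum_add_distrib, Finset.sum_const, Finset.card_univ, nsmul_eq_mul,
              ← Finset.mul_sum]
            ring
        _ ≤ N * L * ∑ a, z (Sum.inl a) ^ 2 + N * L * ∑ b, z (Sum.inr b) ^ 2 := by
            have p1 : 0 ≤ ∑ a, z (Sum.inl a) ^ 2 := Finset.sum_nonneg fun _ _ => sq_nonneg _
            have p2 : 0 ≤ ∑ b, z (Sum.inr b) ^ 2 := Finset.sum_nonneg fun _ _ => sq_nonneg _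
            gcongr
        _ = _ := by rw [hzz]; ring) s
  have hsub : ({ω : Fin s → α × β | ¬ OpNormLE (matOf (sampleOp ω w - w)) (‖w‖ / (4 * b))} :
        Finset (Fin s → α × β))
      ⊆ ({ω : Fin s → α × β | ¬ ∀ z, |∑ i, z ⬝ᵥ Y (ω i) *ᵥ z
          - s / N * ∑ e, z ⬝ᵥ Y e *ᵥ z| ≤ s * (1 / 4) * (z ⬝ᵥ z)} :
        Finset (Fin s → α × β)) := by
    intro ω hω
    simp only [Finset.mem_filter, Finset.mem_univ, true_and] at hω ⊢
    intro hcon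
    refine hω fun x y => ?_
    have h := (le_abs_self _).trans (hcon (Sum.elim x y))
    simp only [hq, Sum.elim_inl, Sum.elim_inr] at h
    rw [hdot, Sum.elim_comp_inl, Sum.elim_comp_inr] at h
    have e1 : x ⬝ᵥ matOf (sampleOp ω w - w) *ᵥ y
        = ‖w‖ / (2 * s * b) * (∑ i, 2 * c (ω i) * (x (ω i).1 * y (ω i).2)
          - s / N * ∑ e, 2 * c e * (x e.1 * y e.2)) := by
      rw [dotProduct_matOf_mulVec, dotProduct_sub, dotProduct_sampleOp, dotProduct, mul_sub,
        Finset.mul_sum, Finset.mul_sum, Finset.mul_sum, Finset.mul_sum]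
      congr 1
      · refine Finset.sum_congr rfl fun i _ => ?_
        simp only [hc, ← hN]
        field_simp
      · refine Finset.sum_congr rfl fun i _ => ?_
        simp only [hc]
        field_simp
    rw [e1]
    calc _ ≤ ‖w‖ / (2 * s * b) * (s * (1 / 4) * (x ⬝ᵥ x + y ⬝ᵥ y)) := by gcongr
      _ = _ := by field_simp
  refine (Nat.cast_le.2 (Finset.card_le_card hsub)).trans (key.trans (le_of_eq ?_))
  rw [Fintype.card_sum, show (s : ℝ) * (1 / 4) ^ 2 / (4 * L) = s / (64 * L) by ring]
  push_cast
  rfl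

end Concentration

/-! ### Dual certificates by golfing -/

section Golfing

set_option linter.unusedSectionVars false

open scoped Kronecker

theorem OpNormLE.mono {α β : Type*} [Fintype α] [Fintype β] {W : Matrix α β ℝ} {c e : ℝ}
    (hW : OpNormLE W c) (h : c ≤ e) : OpNormLE W e := fun x y =>
  (hW x y).trans (mul_le_mul_of_nonneg_right h
    (by linarith [dotProduct_self_nonneg_real x, dotProduct_self_nonneg_real y]))

variable {α β : Type} [Fintype α] [DecidableEq α] [Fintype β] [DecidableEq β]

/-- The Frobenius norm dominates the operator norm: Cauchy–Schwarz against the rank-one vector `x ⊗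
y`. -/
theorem OpNormLE.matOf_of_dotProduct_le {v : α × β → ℝ} {c : ℝ} (hc : 0 ≤ c)
    (h : v ⬝ᵥ v ≤ c ^ 2) : OpNormLE (matOf v) c := by
  intro x y
  rw [dotProduct_matOf_mulVec]
  have hx := dotProduct_self_nonneg_real x
  have hy := dotProduct_self_nonneg_real y
  refine abs_le_of_sq_le_sq' ?_ (by positivity) |>.2
  have h1 := dotProduct_sq_le (fun e : α × β => x e.1 * y e.2) v
  have h2 : (fun e : α × β => x e.1 * y e.2) ⬝ᵥ (fun e : α × β => x e.1 * y e.2)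
      = (x ⬝ᵥ x) * (y ⬝ᵥ y) := by
    simp only [dotProduct, Fintype.sum_prod_type, Finset.sum_mul_sum]
    exact Finset.sum_congr rfl fun a _ => Finset.sum_congr rfl fun b _ => by ring
  rw [h2] at h1
  calc _ ≤ (x ⬝ᵥ x) * (y ⬝ᵥ y) * c ^ 2 := h1.trans (by gcongr)
    _ ≤ ((x ⬝ᵥ x + y ⬝ᵥ y) / 2) ^ 2 * c ^ 2 := by
        gcongr
        nlinarith [sq_nonneg (x ⬝ᵥ x - y ⬝ᵥ y)]
    _ = _ := by ring

/-- The vector of entries of a matrix. -/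
def vecOf (M : Matrix α β ℝ) : α × β → ℝ := fun e => M e.1 e.2

theorem matOf_vecOf (M : Matrix α β ℝ) : matOf (vecOf M) = M := rfl

theorem matOf_add (v w : α × β → ℝ) : matOf (v + w) = matOf v + matOf w := rfl

theorem trace_transpose_matOf_mul (v w : α × β → ℝ) :
    ((matOf v)ᵀ * matOf w).trace = v ⬝ᵥ w := by
  simp only [Matrix.trace, Matrix.diag_apply, Matrix.mul_apply, Matrix.transpose_apply, matOf,
    Matrix.of_apply, dotProduct, Fintype.sum_prod_type]
  exact Finset.sum_comm

theorem matOf_kronecker_mulVec (A : Matrix α α ℝ) (B : Matrix β β ℝ) (w : α × β → ℝ) :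
    matOf ((A ⊗ₖ B) *ᵥ w) = A * matOf w * Bᵀ := by
  ext a b
  simp only [matOf, Matrix.of_apply, Matrix.mulVec, dotProduct, Fintype.sum_prod_type,
    Matrix.kroneckerMap_apply, Matrix.mul_apply, Matrix.transpose_apply, Finset.sum_mul]
  rw [Finset.sum_comm]
  exact Finset.sum_congr rfl fun _ _ => Finset.sum_congr rfl fun _ _ => by ring

theorem one_sub_mul_transpose_isSymm {κ : Type*} [Fintype κ] (U : Matrix α κ ℝ) :
    (1 - U * Uᵀ).IsSymm := by
  simp [Matrix.IsSymm, Matrix.transpose_sub, Matrix.transpose_mul]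

theorem one_sub_mul_transpose_idem {κ : Type*} [Fintype κ] [DecidableEq κ] {U : Matrix α κ ℝ}
    (hU : Uᵀ * U = 1) : (1 - U * Uᵀ) * (1 - U * Uᵀ) = 1 - U * Uᵀ := by
  have h2 : (U * Uᵀ) * (U * Uᵀ) = U * Uᵀ := by
    rw [show (U * Uᵀ) * (U * Uᵀ) = U * (Uᵀ * U) * Uᵀ by simp only [Matrix.mul_assoc], hU,
      Matrix.mul_one]
  rw [sub_mul, mul_sub, mul_sub, h2]
  simp

theorem one_sub_mul_transpose_mul {κ : Type*} [Fintype κ] [DecidableEq κ] {U : Matrix α κ ℝ}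
    (hU : Uᵀ * U = 1) : (1 - U * Uᵀ) * U = 0 := by
  rw [Matrix.sub_mul, Matrix.mul_assoc, hU]
  simp

namespace CompactSVD

variable {M : Matrix α β ℝ} (S : CompactSVD M)

/-- The projection `Z ↦ (1 - U Uᵀ) Z (1 - V Vᵀ)` on entry vectors. -/
def perpProj : Matrix (α × β) (α × β) ℝ := (1 - S.U * S.Uᵀ) ⊗ₖ (1 - S.V * S.Vᵀ)

/-- The projection onto the tangent space of the matrices of fixed rank. -/
def tangentProj : Matrix (α × β) (α × β) ℝ := 1 - S.perpProj

theorem perpProj_isSymm : S.perpProj.IsSymm := by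
  rw [Matrix.IsSymm, perpProj, ← Matrix.kroneckerMap_transpose, one_sub_mul_transpose_isSymm,
    one_sub_mul_transpose_isSymm]

theorem perpProj_idem : S.perpProj * S.perpProj = S.perpProj := by
  rw [perpProj, ← Matrix.mul_kronecker_mul, one_sub_mul_transpose_idem S.U_orth,
    one_sub_mul_transpose_idem S.V_orth]

theorem tangentProj_isSymm : S.tangentProj.IsSymm := Matrix.isSymm_one.sub S.perpProj_isSymm

theorem tangentProj_idem : S.tangentProj * S.tangentProj = S.tangentProj := by
  rw [tangentProj, sub_mul, mul_sub, mul_sub, S.perpProj_idem]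
  simp

theorem matOf_perpProj_mulVec (w : α × β → ℝ) :
    matOf (S.perpProj *ᵥ w) = (1 - S.U * S.Uᵀ) * matOf w * (1 - S.V * S.Vᵀ) := by
  rw [perpProj, matOf_kronecker_mulVec, one_sub_mul_transpose_isSymm]

theorem perpProj_mulVec_vecOf_mul (B : Matrix (Fin S.rk) β ℝ) :
    S.perpProj *ᵥ vecOf (S.U * B) = 0 := by
  have h : matOf (S.perpProj *ᵥ vecOf (S.U * B)) = 0 := by
    rw [matOf_perpProj_mulVec, matOf_vecOf, ← Matrix.mul_assoc, one_sub_mul_transpose_mul S.U_orth]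
    simp
  funext e
  exact congrFun (congrFun h e.1) e.2

theorem perpProj_mulVec_UV : S.perpProj *ᵥ vecOf (S.U * S.Vᵀ) = 0 :=
  S.perpProj_mulVec_vecOf_mul _

theorem perpProj_mulVec_self : S.perpProj *ᵥ vecOf M = 0 := by
  have h : vecOf M = vecOf (S.U * (Matrix.diagonal S.s * S.Vᵀ)) := by
    rw [← Matrix.mul_assoc, ← S.eq]
  rw [h, S.perpProj_mulVec_vecOf_mul]

theorem tangentProj_mulVec (w : α × β → ℝ) : S.tangentProj *ᵥ w = w - S.perpProj *ᵥ w := by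
  rw [tangentProj, Matrix.sub_mulVec, Matrix.one_mulVec]

/-- The diagonal entry is `1 - (1 - u)(1 - v) = u + v - u v` with `u, v ≥ 0`. This is where row and
column incoherence enter. -/
theorem tangentProj_apply_self_le (e : α × β) :
    S.tangentProj e e ≤ (S.U * S.Uᵀ) e.1 e.1 + (S.V * S.Vᵀ) e.2 e.2 := by
  have h1 : 0 ≤ (S.U * S.Uᵀ) e.1 e.1 := by
    rw [Matrix.mul_apply]
    exact Finset.sum_nonneg fun k _ => mul_self_nonneg _
  have h2 : 0 ≤ (S.V * S.Vᵀ) e.2 e.2 := by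
    rw [Matrix.mul_apply]
    exact Finset.sum_nonneg fun k _ => mul_self_nonneg _
  simp only [tangentProj, perpProj, Matrix.sub_apply, Matrix.kroneckerMap_apply, Matrix.one_apply_eq]
  nlinarith

/-- Compressing by orthogonal projections on both sides shortens the test vectors. -/
theorem opNormLE_perpProj {w : α × β → ℝ} {c : ℝ} (hc : 0 ≤ c) (h : OpNormLE (matOf w) c) :
    OpNormLE (matOf (S.perpProj *ᵥ w)) c := by
  intro x y
  have e : x ⬝ᵥ matOf (S.perpProj *ᵥ w) *ᵥ y
      = ((1 - S.U * S.Uᵀ) *ᵥ x) ⬝ᵥ matOf w *ᵥ ((1 - S.V * S.Vᵀ) *ᵥ y) := by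
    rw [matOf_perpProj_mulVec, ← Matrix.mulVec_mulVec, ← Matrix.mulVec_mulVec,
      Matrix.dotProduct_mulVec x, ← Matrix.mulVec_transpose, one_sub_mul_transpose_isSymm]
  rw [e, dotProduct_split S.U_orth x, dotProduct_split S.V_orth y]
  refine (h _ _).trans (mul_le_mul_of_nonneg_left ?_ hc)
  linarith [dotProduct_self_nonneg_real (S.Uᵀ *ᵥ x), dotProduct_self_nonneg_real (S.Vᵀ *ᵥ y)]

end CompactSVD

/-- All steps of a process that is driven by `ω` are good. -/
def SeqGood {σ B : Type*} (good : σ → B → Prop) (next : σ → B → σ) :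
    (q : ℕ) → σ → (Fin q → B) → Prop
  | 0, _, _ => True
  | q + 1, w, ω => good w (ω 0) ∧ SeqGood good next q (next w (ω 0)) (Fin.tail ω)

theorem card_filter_eq_sum_ite {C : Type*} [Fintype C] (p : C → Prop) [DecidablePred p] :
    (({c | p c} : Finset C).card : ℝ) = ∑ c, if p c then (1 : ℝ) else 0 := by
  rw [Finset.card_filter]
  push_cast
  rfl

-- The state before each step is determined by the earlier batches, so conditionally on these the
-- next batch is still uniform and fails with proportion at most `δ`. The invariant `I` carries what
-- the one-step estimate needs.
open Classical in
theorem card_not_seqGood_le {σ B : Type*} [Fintype B] {good : σ → B → Prop} {next : σ → B → σ}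
    {I : σ → Prop} (hI : ∀ w, I w → ∀ η, I (next w η)) {δ : ℝ}
    (h : ∀ w, I w → (({η | ¬ good w η} : Finset B).card : ℝ) ≤ δ * Fintype.card B) (q : ℕ) {w : σ}
    (hw : I w) :
    (({ω | ¬ SeqGood good next q w ω} : Finset (Fin q → B)).card : ℝ)
      ≤ q * δ * Fintype.card B ^ q := by
  induction q generalizing w with
  | zero => simp [SeqGood]
  | succ q ih =>
    rw [card_filter_eq_sum_ite, Fin.sum_univ_cons]
    calc _ ≤ ∑ η, ∑ ω : Fin q → B, ((if ¬ good w η then (1 : ℝ) else 0)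
            + if ¬ SeqGood good next q (next w η) ω then (1 : ℝ) else 0) := by
          refine Finset.sum_le_sum fun η _ => Finset.sum_le_sum fun ω _ => ?_
          simp only [SeqGood, Fin.cons_zero, Fin.tail_cons]
          by_cases h1 : good w η <;> by_cases h2 : SeqGood good next q (next w η) ω <;>
            simp [h1, h2]
      _ = Fintype.card B ^ q * ∑ η, (if ¬ good w η then (1 : ℝ) else 0)
            + ∑ η, ∑ ω : Fin q → B,
              (if ¬ SeqGood good next q (next w η) ω then (1 : ℝ) else 0) := by
          simp only [Finset.sum_add_distrib, Finset.sum_const, Finset.card_univ, nsmul_eq_mul,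
            Fintype.card_fun, Fintype.card_fin, Finset.mul_sum, Nat.cast_pow]
      _ ≤ Fintype.card B ^ q * (δ * Fintype.card B)
            + ∑ _η : B, q * δ * Fintype.card B ^ q := by
          refine add_le_add (mul_le_mul_of_nonneg_left ?_ (by positivity))
            (Finset.sum_le_sum fun η _ => ?_)
          · rw [← card_filter_eq_sum_ite]; exact h w hw
          · have := ih (hI w hw η)
            rwa [card_filter_eq_sum_ite] at this
      _ = _ := by
          rw [Finset.sum_const, Finset.card_univ, nsmul_eq_mul]
          push_cast
          ring

/-- The batch `ω` of samples acts well on `w`. -/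
def GolfGood (P : Matrix (α × β) (α × β) ℝ) (b : ℝ) {s : ℕ} (w : α × β → ℝ)
    (ω : Fin s → α × β) : Prop :=
  (∀ x, |(Fintype.card (α × β) : ℝ) / s * ∑ i, (P *ᵥ x) (ω i) ^ 2 - x ⬝ᵥ P *ᵥ x|
      ≤ 1 / 2 * (x ⬝ᵥ x))
    ∧ ‖P *ᵥ sampleOp ω w - w‖ ≤ ‖w‖ / 2
    ∧ OpNormLE (matOf (sampleOp ω w - w)) (‖w‖ / (4 * b))

/-- The residual after one golfing step. -/
noncomputable def golfNext (P : Matrix (α × β) (α × β) ℝ) {s : ℕ} (w : α × β → ℝ)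
    (ω : Fin s → α × β) : α × β → ℝ :=
  w - P *ᵥ sampleOp ω w

theorem mulVec_golfNext {P : Matrix (α × β) (α × β) ℝ} (hPP : P * P = P) {s : ℕ}
    {w : α × β → ℝ} (hw : P *ᵥ w = w) (ω : Fin s → α × β) :
    P *ᵥ golfNext P w ω = golfNext P w ω := by
  rw [golfNext, Matrix.mulVec_sub, hw, Matrix.mulVec_mulVec, hPP]

theorem sum_sq_ge_of_golfGood {P : Matrix (α × β) (α × β) ℝ} (hPs : P.IsSymm) (hPP : P * P = P)
    {b : ℝ} {s : ℕ} {w : α × β → ℝ} {ω : Fin s → α × β} (h : GolfGood P b w ω) (x : α × β → ℝ) :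
    1 / 2 * ((P *ᵥ x) ⬝ᵥ (P *ᵥ x))
      ≤ (Fintype.card (α × β) : ℝ) / s * ∑ i, (P *ᵥ x) (ω i) ^ 2 := by
  have h1 := (abs_le.1 (h.1 (P *ᵥ x))).1
  rw [dotProduct_proj hPs hPP, Matrix.mulVec_mulVec, hPP] at h1
  linarith

/-- A golfing step halves the Euclidean norm of the residual. -/
theorem dotProduct_golfNext_le {P : Matrix (α × β) (α × β) ℝ} (hPs : P.IsSymm) {b : ℝ} {s : ℕ}
    {w : α × β → ℝ} (hw : P *ᵥ w = w) {ω : Fin s → α × β} (h : GolfGood P b w ω) :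
    golfNext P w ω ⬝ᵥ golfNext P w ω ≤ 1 / 4 * (w ⬝ᵥ w) := by
  set g := golfNext P w ω with hg
  set c : ℝ := (Fintype.card (α × β) : ℝ) / s with hc
  have hbil : ∀ x, c * ∑ i, (P *ᵥ x) (ω i) * w (ω i) - x ⬝ᵥ w = -(x ⬝ᵥ g) := fun x => by
    rw [hg, golfNext, dotProduct_sub, Matrix.dotProduct_mulVec, ← Matrix.mulVec_transpose, hPs.eq,
      dotProduct_sampleOp]
    ring
  have hexp : ∀ x (r : ℝ), c * ∑ i, (P *ᵥ (x + r • w)) (ω i) ^ 2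
      = c * ∑ i, (P *ᵥ x) (ω i) ^ 2 + 2 * r * (c * ∑ i, (P *ᵥ x) (ω i) * w (ω i))
        + r ^ 2 * (c * ∑ i, w (ω i) ^ 2) := fun x r => by
    rw [Matrix.mulVec_add, Matrix.mulVec_smul, hw]
    simp only [Finset.mul_sum, ← Finset.sum_add_distrib]
    refine Finset.sum_congr rfl fun i _ => ?_
    simp only [Pi.add_apply, Pi.smul_apply, smul_eq_mul]
    ring
  have hxw : ∀ x, (P *ᵥ x) ⬝ᵥ w = x ⬝ᵥ w := fun x => by
    conv_rhs => rw [← hw, Matrix.dotProduct_mulVec, ← Matrix.mulVec_transpose, hPs.eq]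
  have hdot : ∀ x (r : ℝ), (x + r • w) ⬝ᵥ P *ᵥ (x + r • w)
      = x ⬝ᵥ P *ᵥ x + 2 * r * (x ⬝ᵥ w) + r ^ 2 * (w ⬝ᵥ w) := fun x r => by
    rw [Matrix.mulVec_add, Matrix.mulVec_smul, hw, dotProduct_add, add_dotProduct, add_dotProduct,
      dotProduct_smul, smul_dotProduct, dotProduct_comm w (P *ᵥ x), hxw, smul_dotProduct,
      dotProduct_smul]
    simp only [smul_eq_mul]
    ring
  have hself : ∀ x (r : ℝ), (x + r • w) ⬝ᵥ (x + r • w)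
      = x ⬝ᵥ x + 2 * r * (x ⬝ᵥ w) + r ^ 2 * (w ⬝ᵥ w) := fun x r => by
    rw [dotProduct_add, add_dotProduct, add_dotProduct, dotProduct_smul, smul_dotProduct,
      dotProduct_comm w x, smul_dotProduct, dotProduct_smul]
    simp only [smul_eq_mul]
    ring
  -- Polarization: the deviation form `H` satisfies `H w = -g` when paired with any vector, and is
  -- at most half the squared length on the diagonal. Comparing it at `-2g + w` and `-2g - w` gives
  -- `8|g|² ≤ 4|g|² + |w|²`; the factor `2` balances the two lengths.
  have hx := hbil ((-2 : ℝ) • g)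
  have h1 := (abs_le.1 (h.1 ((-2 : ℝ) • g + (1 : ℝ) • w))).2
  have h2 := (abs_le.1 (h.1 ((-2 : ℝ) • g + (-1 : ℝ) • w))).1
  rw [← hc, hexp, hdot, hself] at h1 h2
  have hgg : ((-2 : ℝ) • g) ⬝ᵥ g = -2 * (g ⬝ᵥ g) := by rw [smul_dotProduct, smul_eq_mul]
  have hgg' : ((-2 : ℝ) • g) ⬝ᵥ ((-2 : ℝ) • g) = 4 * (g ⬝ᵥ g) := by
    rw [smul_dotProduct, dotProduct_smul, smul_eq_mul, smul_eq_mul]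
    ring
  rw [hgg'] at h1 h2
  rw [hgg] at hx
  linarith

theorem sampleOp_eq_zero {E : Type*} [Fintype E] [DecidableEq E] {s : ℕ} {ω : Fin s → E}
    {e : E} (h : ∀ i, ω i ≠ e) (w : E → ℝ) : sampleOp ω w e = 0 := by
  simp only [sampleOp, Pi.smul_apply, Finset.sum_apply, smul_eq_mul]
  rw [Finset.sum_eq_zero fun i _ => Pi.single_eq_of_ne (h i).symm _, mul_zero]

namespace CompactSVD

variable {M : Matrix α β ℝ} (S : CompactSVD M)

/-- The golfing scheme yields an approximate dual certificate. -/
theorem exists_certificate {b : ℝ} (hb : 0 < b) {s : ℕ} (q : ℕ) {w : α × β → ℝ}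
    (hw : S.tangentProj *ᵥ w = w) (ω : Fin q → Fin s → α × β)
    (h : SeqGood (GolfGood S.tangentProj b) (golfNext S.tangentProj) q w ω) :
    ∃ y : α × β → ℝ, (∀ e, (∀ j i, ω j i ≠ e) → y e = 0)
      ∧ (w - S.tangentProj *ᵥ y) ⬝ᵥ (w - S.tangentProj *ᵥ y) ≤ (1 / 4) ^ q * (w ⬝ᵥ w)
      ∧ OpNormLE (matOf (S.perpProj *ᵥ y)) (‖w‖ / (2 * b)) := by
  induction q generalizing w with
  | zero =>
    refine ⟨0, fun _ _ => rfl, by simp, fun x y => ?_⟩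
    rw [dotProduct_matOf_mulVec, Matrix.mulVec_zero, dotProduct_zero]
    have := dotProduct_self_nonneg_real x
    have := dotProduct_self_nonneg_real y
    positivity
  | succ q ih =>
    obtain ⟨hg, hrest⟩ := h
    obtain ⟨y, hy1, hy2, hy3⟩ := ih (mulVec_golfNext S.tangentProj_idem hw (ω 0)) (Fin.tail ω) hrest
    -- The certificate sums the sampled residuals. As `w` is tangential, the orthogonal part of the
    -- new term is that of the sampling error, and halving the entries makes `1/4 + 1/2 · 1/2 = 1/2`
    -- close the induction.
    refine ⟨sampleOp (ω 0) w + y, fun e he => ?_, ?_, ?_⟩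
    · rw [Pi.add_apply, sampleOp_eq_zero (he 0), hy1 e fun j i => he j.succ i, add_zero]
    · rw [Matrix.mulVec_add, ← sub_sub]
      refine hy2.trans ?_
      have := dotProduct_golfNext_le S.tangentProj_isSymm hw hg
      calc _ ≤ (1 / 4) ^ q * (1 / 4 * (w ⬝ᵥ w)) := by gcongr
        _ = _ := by ring
    · have hpw : S.perpProj *ᵥ w = 0 := by
        have := S.tangentProj_mulVec w
        rw [hw] at this
        exact (sub_eq_self.1 this.symm)
      have e : S.perpProj *ᵥ (sampleOp (ω 0) w + y)
          = S.perpProj *ᵥ (sampleOp (ω 0) w - w) + S.perpProj *ᵥ y := by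
        rw [Matrix.mulVec_add, Matrix.mulVec_sub, hpw, sub_zero]
      rw [e, matOf_add]
      refine ((S.opNormLE_perpProj (by positivity) hg.2.2).add hy3).mono ?_
      have hn : ‖golfNext S.tangentProj w (ω 0)‖ ≤ ‖w‖ / 2 := by
        rw [golfNext, norm_sub_rev]; exact hg.2.1
      calc _ ≤ ‖w‖ / (4 * b) + ‖w‖ / 2 / (2 * b) := by gcongr
        _ = _ := by field_simp; ring

/-- If all golfing steps are good, the matrix is the unique minimizer of the nuclear norm. -/
theorem nuclearNorm_lt_of_seqGood {b : ℝ} (hb : 0 < b) {s q : ℕ} (hs : 0 < s) (hq : 0 < q)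
    (hUV : ‖vecOf (S.U * S.Vᵀ)‖ ≤ b)
    (hsmall : (1 / 4) ^ q * (Fintype.card (α × β) * b ^ 2) * (8 * Fintype.card (α × β)) < 1)
    (ω : Fin q → Fin s → α × β)
    (h : SeqGood (GolfGood S.tangentProj b) (golfNext S.tangentProj) q (vecOf (S.U * S.Vᵀ)) ω)
    {X : Matrix α β ℝ} (hX : ∀ j i, X (ω j i).1 (ω j i).2 = M (ω j i).1 (ω j i).2) (hne : X ≠ M) :
    nuclearNorm M < nuclearNorm X := by
  set P := S.tangentProj with hP
  set Q := S.perpProj with hQ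
  set u := vecOf (S.U * S.Vᵀ) with hu
  set N : ℝ := (Fintype.card (α × β) : ℝ) with hN
  have hPu : P *ᵥ u = u := by rw [hP, tangentProj_mulVec, perpProj_mulVec_UV, sub_zero]
  obtain ⟨y, hy1, hy2, hy3⟩ := S.exists_certificate hb q hPu ω h
  set Δ : α × β → ℝ := vecOf X - vecOf M with hΔ
  have hΔω : ∀ j i, Δ (ω j i) = 0 := fun j i => sub_eq_zero.2 (hX j i)
  have hsplit : ∀ v, v = P *ᵥ v + Q *ᵥ v := fun v => by
    rw [hP, tangentProj_mulVec]
    exact (sub_add_cancel _ _).symm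
  have hyΔ : y ⬝ᵥ Δ = 0 := by
    refine Finset.sum_eq_zero fun e _ => ?_
    by_cases he : ∀ j i, ω j i ≠ e
    · rw [hy1 e he, zero_mul]
    · push Not at he
      obtain ⟨j, i, rfl⟩ := he
      rw [hΔω, mul_zero]
  set f2 := (Q *ᵥ Δ) ⬝ᵥ (Q *ᵥ Δ) with hf2
  have hf2nn : 0 ≤ f2 := dotProduct_self_nonneg_real _
  -- On sampled entries `PΔ = -QΔ`, so the near-isometry of one batch bounds the tangential part by
  -- the orthogonal part. The first batch is used.
  have hPΔ : (P *ᵥ Δ) ⬝ᵥ (P *ᵥ Δ) ≤ 2 * N * f2 := by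
    have hgood : ∃ w, GolfGood P b w (ω ⟨0, hq⟩) := by
      cases q with
      | zero => exact absurd hq (lt_irrefl _)
      | succ q => exact ⟨_, h.1⟩
    obtain ⟨w, hw⟩ := hgood
    have h1 := sum_sq_ge_of_golfGood S.tangentProj_isSymm S.tangentProj_idem hw Δ
    have h2 : ∑ i, (P *ᵥ Δ) (ω ⟨0, hq⟩ i) ^ 2 ≤ s * f2 := by
      calc _ ≤ ∑ _i : Fin s, f2 := by
            refine Finset.sum_le_sum fun i _ => ?_
            have h3 := congrFun (hsplit Δ) (ω ⟨0, hq⟩ i)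
            rw [hΔω, Pi.add_apply] at h3
            rw [eq_neg_of_add_eq_zero_left h3.symm, neg_sq, sq]
            exact Finset.single_le_sum (f := fun e => (Q *ᵥ Δ) e * (Q *ᵥ Δ) e)
              (fun _ _ => mul_self_nonneg _) (Finset.mem_univ _)
        _ = _ := by simp
    have hspos : (0 : ℝ) < s := by exact_mod_cast hs
    have h4 : N / s * ∑ i, (P *ᵥ Δ) (ω ⟨0, hq⟩ i) ^ 2 ≤ N / s * (s * f2) := by gcongr
    rw [show N / s * (s * f2) = N * f2 by field_simp] at h4
    linarith
  have hf2pos : 0 < f2 := by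
    refine hf2nn.lt_of_ne fun h0 => hne ?_
    have hQ0 : Q *ᵥ Δ = 0 := dotProduct_self_eq_zero.1 h0.symm
    have hP0 : P *ᵥ Δ = 0 := by
      refine dotProduct_self_eq_zero.1 (le_antisymm ?_ (dotProduct_self_nonneg_real _))
      simpa [← h0] using hPΔ
    have hΔ0 : Δ = 0 := by rw [hsplit Δ, hP0, hQ0, add_zero]
    ext a c
    exact sub_eq_zero.1 (congrFun hΔ0 (a, c))
  set f := √f2 with hf
  have hfpos : 0 < f := Real.sqrt_pos.2 hf2pos
  have hff : f ^ 2 = f2 := Real.sq_sqrt hf2nn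
  have hsymP : ∀ v w, v ⬝ᵥ P *ᵥ w = (P *ᵥ v) ⬝ᵥ w := fun v w => by
    rw [Matrix.dotProduct_mulVec, ← Matrix.mulVec_transpose, S.tangentProj_isSymm]
  have hsymQ : ∀ v w, v ⬝ᵥ Q *ᵥ w = (Q *ᵥ v) ⬝ᵥ w := fun v w => by
    rw [Matrix.dotProduct_mulVec, ← Matrix.mulVec_transpose, S.perpProj_isSymm]
  have hQQ : ∀ v, Q *ᵥ (Q *ᵥ v) = Q *ᵥ v := fun v => by
    rw [Matrix.mulVec_mulVec, S.perpProj_idem]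
  have hPP : ∀ v, P *ᵥ (P *ᵥ v) = P *ᵥ v := fun v => by
    rw [Matrix.mulVec_mulVec, S.tangentProj_idem]
  set g := u - P *ᵥ y with hg
  have hgΔ : g ⬝ᵥ Δ = g ⬝ᵥ P *ᵥ Δ := by
    rw [hsymP, hg, Matrix.mulVec_sub, hPu, hPP]
  have huu : u ⬝ᵥ u ≤ N * b ^ 2 := by
    calc u ⬝ᵥ u ≤ ∑ _e : α × β, b ^ 2 := by
          refine Finset.sum_le_sum fun e _ => ?_
          rw [← sq]
          exact sq_le_sq.2 (((norm_le_pi_norm u e).trans hUV).trans (le_abs_self _))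
      _ = _ := by simp [hN]
  have hgsmall : |g ⬝ᵥ P *ᵥ Δ| < f / 2 := by
    refine abs_lt_of_sq_lt_sq ?_ (by positivity)
    calc (g ⬝ᵥ P *ᵥ Δ) ^ 2 ≤ (g ⬝ᵥ g) * ((P *ᵥ Δ) ⬝ᵥ (P *ᵥ Δ)) := dotProduct_sq_le _ _
      _ ≤ ((1 / 4) ^ q * (N * b ^ 2)) * (2 * N * f2) := by
          refine mul_le_mul (hy2.trans ?_) hPΔ (dotProduct_self_nonneg_real _) (by positivity)
          gcongr
      _ = ((1 / 4) ^ q * (N * b ^ 2) * (8 * N)) * (f2 / 4) := by ring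
      _ < 1 * (f2 / 4) := by gcongr
      _ = (f / 2) ^ 2 := by rw [div_pow, hff]; ring
  -- Half of the operator norm budget goes to the certificate, half to the direction `QΔ` normalized
  -- in Frobenius norm. The latter gains `f / 2`, which beats the tangential error.
  set z : α × β → ℝ := Q *ᵥ y + (1 / (2 * f)) • (Q *ᵥ Δ) with hz
  have hQz : Q *ᵥ z = z := by
    rw [hz, Matrix.mulVec_add, Matrix.mulVec_smul, hQQ, hQQ]
  have hWnorm : OpNormLE (matOf z) 1 := by
    have h1 : OpNormLE (matOf (Q *ᵥ y)) (1 / 2) := by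
      refine hy3.mono ?_
      rw [div_le_iff₀ (by positivity)]
      linarith
    have h2 : OpNormLE (matOf ((1 / (2 * f)) • (Q *ᵥ Δ))) (1 / 2) := by
      refine OpNormLE.matOf_of_dotProduct_le (by norm_num) (le_of_eq ?_)
      rw [smul_dotProduct, dotProduct_smul, ← hf2, ← hff, smul_eq_mul, smul_eq_mul]
      field_simp
    have := h1.add h2
    rw [hz, matOf_add]
    exact this.mono (by norm_num)
  have hdual : OpNormLE (matOf (u + z)) 1 := by
    rw [matOf_add, hu, matOf_vecOf]
    refine S.opNormLE_UV_add hWnorm ?_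
    rw [← S.matOf_perpProj_mulVec, hQz]
  have hlow := trace_le_nuclearNorm (M := matOf (vecOf X)) hdual
  rw [trace_transpose_matOf_mul, matOf_vecOf] at hlow
  have huM : u ⬝ᵥ vecOf M = nuclearNorm M := by
    rw [← S.sum_s_eq_nuclearNorm, ← S.trace_UV, ← trace_transpose_matOf_mul, matOf_vecOf,
      matOf_vecOf]
  have hzM : z ⬝ᵥ vecOf M = 0 := by
    rw [← hQz, ← hsymQ, hQ, S.perpProj_mulVec_self, dotProduct_zero]
  have hXe : vecOf X = vecOf M + Δ := by rw [hΔ]; abel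
  have hzΔ : (u + z) ⬝ᵥ Δ = g ⬝ᵥ Δ + f / 2 := by
    have e1 : u + z = g + y + (1 / (2 * f)) • (Q *ᵥ Δ) := by
      have e2 : g + y = u + Q *ᵥ y := by
        have e3 : y - P *ᵥ y = Q *ᵥ y := sub_eq_iff_eq_add'.2 (hsplit y)
        rw [hg, sub_add_eq_add_sub, add_sub_assoc, e3]
      rw [e2, hz, add_assoc]
    rw [e1, add_dotProduct, add_dotProduct, hyΔ, add_zero, smul_dotProduct, ← hQQ, ← hsymQ,
      smul_eq_mul, ← hf2, ← hff]
    field_simp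
  rw [hXe, dotProduct_add, add_dotProduct, huM, hzM, add_zero, hzΔ, hgΔ] at hlow
  have := (abs_lt.1 hgsmall).1
  linarith

end CompactSVD

end Golfing

/-! ### Sampling with and without replacement -/

section Replacement

set_option linter.unusedSectionVars false

variable {E : Type*} [Fintype E] [DecidableEq E]

theorem Finset.sum_powersetCard_univ_map_perm (m : ℕ) (π : Equiv.Perm E) (f : Finset E → ℕ) :
    ∑ J ∈ (univ : Finset E).powersetCard m, f (J.map π.toEmbedding)
      = ∑ J ∈ (univ : Finset E).powersetCard m, f J := by
  refine Finset.sum_nbij' (fun J => J.map π.toEmbedding) (fun J => J.map π.symm.toEmbedding)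
    ?_ ?_ ?_ ?_ fun _ _ => rfl
  · intro J hJ
    rw [Finset.mem_powersetCard_univ] at hJ ⊢
    rw [Finset.card_map, hJ]
  · intro J hJ
    rw [Finset.mem_powersetCard_univ] at hJ ⊢
    rw [Finset.card_map, hJ]
  · intro J _
    ext x
    simp
  · intro J _
    ext x
    simp

theorem Finset.exists_perm_map_eq {J K : Finset E} (h : J.card = K.card) :
    ∃ π : Equiv.Perm E, J.map π.toEmbedding = K := by
  have e : {x // x ∈ J} ≃ {x // x ∈ K} := Fintype.equivOfCardEq (by simpa using h)
  refine ⟨e.extendSubtype, Finset.eq_of_subset_of_card_le (fun x hx => ?_) (by simp [h])⟩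
  obtain ⟨y, hy, rfl⟩ := Finset.mem_map.1 hx
  exact e.extendSubtype_mem y hy

/-- Averaging over permutations. -/
theorem sum_perm_map_mul_choose (f : Finset E → ℕ) (J : Finset E) :
    (∑ π : Equiv.Perm E, f (J.map π.toEmbedding))
        * ((Finset.univ : Finset E).powersetCard J.card).card
      = Fintype.card (Equiv.Perm E) * ∑ K ∈ (Finset.univ : Finset E).powersetCard J.card, f K := by
  have h1 : ∀ K ∈ (Finset.univ : Finset E).powersetCard J.card,
      ∑ π : Equiv.Perm E, f (K.map π.toEmbedding) = ∑ π : Equiv.Perm E, f (J.map π.toEmbedding) := by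
    intro K hK
    obtain ⟨τ, rfl⟩ := Finset.exists_perm_map_eq (Finset.mem_powersetCard_univ.1 hK).symm
    refine Fintype.sum_equiv (Equiv.mulRight τ) _ _ fun π => ?_
    rw [Finset.map_map]
    rfl
  calc _ = ∑ K ∈ (Finset.univ : Finset E).powersetCard J.card,
        ∑ π : Equiv.Perm E, f (K.map π.toEmbedding) := by
        rw [Finset.sum_congr rfl h1, Finset.sum_const, smul_eq_mul, mul_comm]
    _ = _ := by
        rw [Finset.sum_comm]
        simp only [Finset.sum_powersetCard_univ_map_perm]
        rw [Finset.sum_const, Finset.card_univ, smul_eq_mul]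

/-- A decreasing event is less likely for a uniform `m`-subset than for the set of values of at most
`m` independent uniform samples. -/
theorem card_bad_mul_le {ι : Type*} [Fintype ι] [DecidableEq ι] {bad : Finset E → Prop}
    [DecidablePred bad]
    (hbad : ∀ A B, A ⊆ B → bad B → bad A) {m : ℕ} (hι : Fintype.card ι ≤ m)
    (hm : m ≤ Fintype.card E) :
    (((Finset.univ : Finset E).powersetCard m).filter bad).card * Fintype.card E ^ Fintype.card ι
      ≤ ({ω : ι → E | bad (Finset.univ.image ω)} : Finset (ι → E)).card
        * ((Finset.univ : Finset E).powersetCard m).card := by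
  set f : Finset E → ℕ := fun A => if bad A then 1 else 0 with hf
  set g := Fintype.card (Equiv.Perm E) with hg
  have hgpos : 0 < g := Fintype.card_pos
  -- The sampled set is enlarged arbitrarily to size `m`. A random permutation of `E` makes the
  -- enlarged set uniform among `m`-subsets and preserves the law of `ω`.
  have hJ : ∀ ω : ι → E, ∃ J : Finset E, Finset.univ.image ω ⊆ J ∧ J.card = m := fun ω =>
    Finset.exists_superset_card_eq (Finset.card_image_le.trans (by simpa using hι)) hm
  choose J hJsub hJcard using hJ
  rw [Finset.card_filter, Finset.card_filter]
  change (∑ K ∈ _, f K) * _ ≤ (∑ ω : ι → E, f (Finset.univ.image ω)) * _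
  refine Nat.le_of_mul_le_mul_left ?_ hgpos
  have hperm : ∀ π : Equiv.Perm E, ∑ ω : ι → E, f (Finset.univ.image ω)
      = ∑ ω : ι → E, f ((Finset.univ.image ω).map π.toEmbedding) := by
    intro π
    refine (Fintype.sum_equiv (Equiv.arrowCongr (Equiv.refl ι) π) _ _ fun ω => ?_).symm
    congr 1
    ext x
    simp [Equiv.eq_symm_apply]
  calc g * ((∑ K ∈ (Finset.univ : Finset E).powersetCard m, f K)
        * Fintype.card E ^ Fintype.card ι)
      = ∑ ω : ι → E, (∑ π : Equiv.Perm E, f ((J ω).map π.toEmbedding))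
          * ((Finset.univ : Finset E).powersetCard m).card := by
        have : ∀ ω, (∑ π : Equiv.Perm E, f ((J ω).map π.toEmbedding))
            * ((Finset.univ : Finset E).powersetCard m).card
            = g * ∑ K ∈ (Finset.univ : Finset E).powersetCard m, f K := fun ω => by
          rw [← hJcard ω, sum_perm_map_mul_choose]
        rw [Finset.sum_congr rfl fun ω _ => this ω, Finset.sum_const, Finset.card_univ,
          Fintype.card_fun, smul_eq_mul]
        ring
    _ ≤ ∑ ω : ι → E, (∑ π : Equiv.Perm E, f ((Finset.univ.image ω).map π.toEmbedding))
          * ((Finset.univ : Finset E).powersetCard m).card := by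
        refine Finset.sum_le_sum fun ω _ => Nat.mul_le_mul_right _ (Finset.sum_le_sum fun π _ => ?_)
        simp only [hf]
        split_ifs with h1 h2
        · exact le_rfl
        · exact absurd (hbad _ _ (Finset.map_subset_map.2 (hJsub ω)) h1) h2
        · exact zero_le_one
        · exact le_rfl
    _ = g * ((∑ ω : ι → E, f (Finset.univ.image ω))
          * ((Finset.univ : Finset E).powersetCard m).card) := by
        rw [← Finset.sum_mul, Finset.sum_comm, ← Finset.sum_congr rfl fun π _ => hperm π,
          Finset.sum_const, Finset.card_univ, smul_eq_mul, mul_assoc]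

end Replacement

/-! ### Exact matrix completion -/

section MatrixCompletion

set_option linter.unusedSectionVars false

variable {α β : Type} [Fintype α] [DecidableEq α] [Fintype β] [DecidableEq β]

namespace CompactSVD

variable {M : Matrix α β ℝ} (S : CompactSVD M) {ρ : ℝ}

theorem incoherence_nonneg : 0 ≤ S.incoherence ρ :=
  le_max_of_le_right (Real.iSup_nonneg fun _ => by positivity)

theorem abs_left_le [Nonempty α] (hρ : 0 < ρ) (p p' : α) :
    |(S.U * S.Uᵀ) p p' - (if p = p' then ρ / Fintype.card α else 0)|
      ≤ S.incoherence ρ * √ρ / Fintype.card α := by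
  have h : |(S.U * S.Uᵀ) p p' - (if p = p' then ρ / Fintype.card α else 0)| * Fintype.card α / √ρ
      ≤ S.incoherence ρ :=
    (le_ciSup (f := fun p : α × α => |(S.U * S.Uᵀ) p.1 p.2
        - (if p.1 = p.2 then ρ / Fintype.card α else 0)| * Fintype.card α / √ρ)
      (Set.finite_range _).bddAbove (p, p')).trans
      ((le_max_left _ _).trans (le_max_left _ _))
  have hα : (0 : ℝ) < Fintype.card α := by exact_mod_cast Fintype.card_pos
  rwa [div_le_iff₀ (Real.sqrt_pos.2 hρ), ← le_div_iff₀ hα] at h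

theorem abs_right_le [Nonempty β] (hρ : 0 < ρ) (p p' : β) :
    |(S.V * S.Vᵀ) p p' - (if p = p' then ρ / Fintype.card β else 0)|
      ≤ S.incoherence ρ * √ρ / Fintype.card β := by
  have h : |(S.V * S.Vᵀ) p p' - (if p = p' then ρ / Fintype.card β else 0)| * Fintype.card β / √ρ
      ≤ S.incoherence ρ :=
    (le_ciSup (f := fun p : β × β => |(S.V * S.Vᵀ) p.1 p.2
        - (if p.1 = p.2 then ρ / Fintype.card β else 0)| * Fintype.card β / √ρ)
      (Set.finite_range _).bddAbove (p, p')).trans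
      ((le_max_right _ _).trans (le_max_left _ _))
  have hβ : (0 : ℝ) < Fintype.card β := by exact_mod_cast Fintype.card_pos
  rwa [div_le_iff₀ (Real.sqrt_pos.2 hρ), ← le_div_iff₀ hβ] at h

theorem abs_cross_le [Nonempty α] [Nonempty β] (hρ : 0 < ρ) (p : α) (q : β) :
    |(S.U * S.Vᵀ) p q| ≤ S.incoherence ρ * √ρ / √(Fintype.card (α × β) : ℝ) := by
  have h : |(S.U * S.Vᵀ) p q| * √(Fintype.card α * Fintype.card β : ℝ) / √ρ ≤ S.incoherence ρ :=
    (le_ciSup (f := fun p : α × β => |(S.U * S.Vᵀ) p.1 p.2|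
        * √(Fintype.card α * Fintype.card β : ℝ) / √ρ)
      (Set.finite_range _).bddAbove (p, q)).trans (le_max_right _ _)
  have hN : (0 : ℝ) < √(Fintype.card α * Fintype.card β : ℝ) := by
    have h1 : (0 : ℝ) < Fintype.card α := by exact_mod_cast Fintype.card_pos
    have h2 : (0 : ℝ) < Fintype.card β := by exact_mod_cast Fintype.card_pos
    positivity
  rw [Fintype.card_prod]
  push_cast
  rwa [div_le_iff₀ (Real.sqrt_pos.2 hρ), ← le_div_iff₀ hN] at h

theorem trace_left : (S.U * S.Uᵀ).trace = S.rk := by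
  rw [Matrix.trace_mul_comm, S.U_orth, Matrix.trace_one, Fintype.card_fin]

theorem sum_sq_UV : ∑ p, ∑ q, (S.U * S.Vᵀ) p q ^ 2 = S.rk := by
  rw [← Matrix.trace_transpose_mul_self_eq, Matrix.transpose_mul, Matrix.transpose_transpose,
    Matrix.mul_assoc, ← Matrix.mul_assoc S.Uᵀ, S.U_orth, Matrix.one_mul, Matrix.trace_mul_comm,
    S.V_orth, Matrix.trace_one, Fintype.card_fin]

/-- The incoherence parameter cannot be small, whatever the rank. -/
theorem half_le_incoherence [Nonempty α] [Nonempty β] (hρ : 1 ≤ ρ) : 1 / 2 ≤ S.incoherence ρ := by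
  set μ := S.incoherence ρ with hμ
  have hμ0 : 0 ≤ μ := S.incoherence_nonneg
  have hρ0 : 0 < ρ := by linarith
  have hα : (0 : ℝ) < Fintype.card α := by exact_mod_cast Fintype.card_pos
  have hN : (0 : ℝ) < Fintype.card (α × β) := by exact_mod_cast Fintype.card_pos
  -- The trace of `U Uᵀ` keeps the rank near `ρ`, while the Frobenius norm of `U Vᵀ` forces it below
  -- `μ² ρ`; for `μ < 1/2` these contradict each other.
  have h1 : |(S.rk : ℝ) - ρ| ≤ μ * √ρ := by
    have e : (S.rk : ℝ) - ρ = ∑ p, ((S.U * S.Uᵀ) p p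
        - (if p = p then ρ / Fintype.card α else 0)) := by
      simp only [if_true, Finset.sum_sub_distrib, Finset.sum_const, Finset.card_univ, nsmul_eq_mul]
      rw [mul_div_cancel₀ _ hα.ne', ← S.trace_left]
      rfl
    rw [e]
    refine (Finset.abs_sum_le_sum_abs _ _).trans
      ((Finset.sum_le_sum fun p _ => S.abs_left_le hρ0 p p).trans_eq ?_)
    rw [Finset.sum_const, Finset.card_univ, nsmul_eq_mul, mul_div_cancel₀ _ hα.ne']
  have h2 : (S.rk : ℝ) ≤ μ ^ 2 * ρ := by
    rw [← S.sum_sq_UV]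
    calc _ ≤ ∑ _p : α, ∑ _q : β, (μ * √ρ / √(Fintype.card (α × β) : ℝ)) ^ 2 :=
          Finset.sum_le_sum fun p _ => Finset.sum_le_sum fun q _ =>
            sq_le_sq.2 ((S.abs_cross_le hρ0 p q).trans (le_abs_self _))
      _ = Fintype.card (α × β) * (μ * √ρ / √(Fintype.card (α × β) : ℝ)) ^ 2 := by
          simp only [Finset.sum_const, Finset.card_univ, nsmul_eq_mul, Fintype.card_prod]
          push_cast
          ring
      _ = μ ^ 2 * ρ := by
          rw [div_pow, mul_pow, Real.sq_sqrt hρ0.le, Real.sq_sqrt hN.le]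
          field_simp
  by_contra! hlt
  have h3 := (abs_le.1 h1).1
  have h4 : √ρ ≤ ρ := Real.sqrt_le_iff.2 ⟨hρ0.le, by nlinarith⟩
  have h6 : μ * √ρ ≤ 1 / 2 * ρ := mul_le_mul hlt.le h4 (Real.sqrt_nonneg _) (by norm_num)
  have h7 : μ ^ 2 * ρ ≤ 1 / 4 * ρ := mul_le_mul_of_nonneg_right (by nlinarith) hρ0.le
  linarith

end CompactSVD

/-- `M` is the unique minimizer of the nuclear norm given its entries on `Ω`. -/
def IsUniqueCompletion (M : Matrix α β ℝ) (Ω : Finset (α × β)) : Prop :=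
  ∀ X : Matrix α β ℝ, (∀ e ∈ Ω, X e.1 e.2 = M e.1 e.2) → X ≠ M → nuclearNorm M < nuclearNorm X

theorem IsUniqueCompletion.mono {M : Matrix α β ℝ} {Ω Ω' : Finset (α × β)} (h : Ω ⊆ Ω')
    (hM : IsUniqueCompletion M Ω) : IsUniqueCompletion M Ω' :=
  fun X hX => hM X fun e he => hX e (h he)

open Classical in
/-- The golfing steps all succeed with high probability. -/
theorem CompactSVD.card_not_seqGood_golf_le [Nonempty α] [Nonempty β] {M : Matrix α β ℝ}
    (S : CompactSVD M) {L b : ℝ} (hL : 0 < L) (hb : 0 < b)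
    (hκ : ∀ e, Fintype.card (α × β) * S.tangentProj e e ≤ L / 2)
    (h1 : Fintype.card (α × β) * b ≤ L / 2)
    (hα : Fintype.card α * (Fintype.card (α × β) * b ^ 2) ≤ L)
    (hβ : Fintype.card β * (Fintype.card (α × β) * b ^ 2) ≤ L) {s : ℕ} (hs : 0 < s) (q : ℕ) :
    (({ω : Fin q → Fin s → α × β | ¬ SeqGood (GolfGood S.tangentProj b) (golfNext S.tangentProj) q
        (vecOf (S.U * S.Vᵀ)) ω} : Finset (Fin q → Fin s → α × β)).card : ℝ)
      ≤ q * ((4 * Fintype.card (α × β) + 2 * (Fintype.card α + Fintype.card β))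
          * Real.exp (-(s / (64 * L)))) * (Fintype.card (α × β) ^ s) ^ q := by
  have hPu : S.tangentProj *ᵥ vecOf (S.U * S.Vᵀ) = vecOf (S.U * S.Vᵀ) := by
    rw [S.tangentProj_mulVec, S.perpProj_mulVec_UV, sub_zero]
  have hcardB : (Fintype.card (Fin s → α × β) : ℝ) = (Fintype.card (α × β) : ℝ) ^ s := by
    rw [Fintype.card_fun, Fintype.card_fin, Nat.cast_pow]
  have key := card_not_seqGood_le (good := GolfGood (s := s) S.tangentProj b)
    (next := golfNext S.tangentProj) (I := fun w => S.tangentProj *ᵥ w = w)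
    (δ := (4 * Fintype.card (α × β) + 2 * (Fintype.card α + Fintype.card β))
          * Real.exp (-(s / (64 * L))))
    (fun w hw η => mulVec_golfNext S.tangentProj_idem hw η) ?_ q hPu
  · rwa [hcardB] at key
  intro w hw
  rw [hcardB]
  have b1 := card_not_sampling_isometry S.tangentProj_isSymm S.tangentProj_idem hL hκ hs
  have b2 := card_not_sampling_entries S.tangentProj_isSymm S.tangentProj_idem hL hκ hs hw
  have b3 := card_not_sampling_opNorm hL hb h1 hα hβ hs w
  have hexp : Real.exp (-((s : ℝ) / (16 * L))) ≤ Real.exp (-(s / (64 * L))) := by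
    refine Real.exp_le_exp.2 (neg_le_neg ?_)
    gcongr
    norm_num
  have hsub : ({η : Fin s → α × β | ¬ GolfGood S.tangentProj b w η} : Finset (Fin s → α × β))
      ⊆ (({ω : Fin s → α × β | ¬ ∀ x, |(Fintype.card (α × β) : ℝ) / s
            * ∑ i, (S.tangentProj *ᵥ x) (ω i) ^ 2 - x ⬝ᵥ S.tangentProj *ᵥ x|
            ≤ 1 / 2 * (x ⬝ᵥ x)} : Finset (Fin s → α × β))
        ∪ ({ω : Fin s → α × β | ¬ ‖S.tangentProj *ᵥ sampleOp ω w - w‖ ≤ ‖w‖ / 2} :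
            Finset (Fin s → α × β)))
        ∪ ({ω : Fin s → α × β | ¬ OpNormLE (matOf (sampleOp ω w - w)) (‖w‖ / (4 * b))} :
            Finset (Fin s → α × β)) := by
    intro η hη
    simp only [Finset.mem_union, Finset.mem_filter, Finset.mem_univ, true_and] at hη ⊢
    by_contra! hcon
    exact hη ⟨hcon.1.1, hcon.1.2, hcon.2⟩
  have hcard := ((Finset.card_le_card hsub).trans (Finset.card_union_le _ _)).trans
    (Nat.add_le_add_right (Finset.card_union_le _ _) _)
  have hcard' := (Nat.cast_le (α := ℝ)).2 hcard
  push_cast at hcard'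
  set N : ℝ := (Fintype.card (α × β) : ℝ) with hN
  have hN0 : 0 ≤ N := by rw [hN]; positivity
  have b4 : 2 * N * Real.exp (-((s : ℝ) / (16 * L))) * N ^ s
      ≤ 2 * N * Real.exp (-((s : ℝ) / (64 * L))) * N ^ s := by gcongr
  calc _ ≤ 2 * N * Real.exp (-((s : ℝ) / (64 * L))) * N ^ s
        + 2 * N * Real.exp (-((s : ℝ) / (64 * L))) * N ^ s
        + 2 * (Fintype.card α + Fintype.card β) * Real.exp (-((s : ℝ) / (64 * L))) * N ^ s := by
        linarith
    _ = _ := by ring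

set_option maxHeartbeats 1000000 in
open Classical in
/-- Exact recovery of an incoherent matrix from `m` uniformly random entries. -/
theorem CompactSVD.card_not_isUniqueCompletion_le [Nonempty α] [Nonempty β] {M : Matrix α β ℝ}
    (S : CompactSVD M) {ρ : ℝ} (hρ : 1 ≤ ρ) {n m : ℕ} (hn : n = max (Fintype.card α) (Fintype.card β))
    (hn2 : 2 ≤ n) (hmN : m ≤ Fintype.card (α × β))
    (hm : 1000000 * (S.incoherence ρ ^ 2 * n * ρ * Real.log n ^ 6) ≤ m) :
    ((((Finset.univ : Finset (α × β)).powersetCard m).filter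
        fun Ω => ¬ IsUniqueCompletion M Ω).card : ℝ)
      ≤ ((n : ℝ) ^ 5)⁻¹ * ((Finset.univ : Finset (α × β)).powersetCard m).card := by
  set μ := S.incoherence ρ with hμ
  have hμh : 1 / 2 ≤ μ := S.half_le_incoherence hρ
  have hρ0 : 0 < ρ := by linarith
  have hμ0 : 0 < μ := by linarith
  set N : ℝ := (Fintype.card (α × β) : ℝ) with hN
  have hNpos : 0 < N := by rw [hN]; exact_mod_cast Fintype.card_pos
  set a : ℝ := (Fintype.card α : ℝ) with ha
  set c : ℝ := (Fintype.card β : ℝ) with hc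
  have hapos : 0 < a := by rw [ha]; exact_mod_cast Fintype.card_pos
  have hcpos : 0 < c := by rw [hc]; exact_mod_cast Fintype.card_pos
  have hNac : N = a * c := by rw [hN, Fintype.card_prod]; push_cast; rfl
  have han : a ≤ n := by rw [ha, hn]; exact_mod_cast le_max_left _ _
  have hcn : c ≤ n := by rw [hc, hn]; exact_mod_cast le_max_right _ _
  have hn2' : (2 : ℝ) ≤ n := by exact_mod_cast hn2
  have hnpos : (0 : ℝ) < n := by linarith
  have hNn : N ≤ (n : ℝ) ^ 2 := by rw [hNac, sq]; gcongr
  set ℓ := Real.log n with hℓ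
  have hℓ1 : 0.69 ≤ ℓ := by
    have := Real.log_le_log (by norm_num) hn2'
    have := Real.log_two_gt_d9
    linarith
  have hℓn : ℓ ≤ n := (Real.log_le_sub_one_of_pos hnpos).trans (by linarith)
  have hexpℓ : ∀ k : ℕ, Real.exp (k * ℓ) = (n : ℝ) ^ k := fun k => by
    rw [Real.exp_nat_mul, hℓ, Real.exp_log hnpos]
  set K : ℝ := μ ^ 2 * ρ * n with hK
  have hμ2 : 1 / 4 ≤ μ ^ 2 := by nlinarith
  have hμρ : 1 / 4 * 1 ≤ μ ^ 2 * ρ := mul_le_mul hμ2 hρ zero_le_one (by positivity)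
  have hK2 : 1 / 4 * 1 * 2 ≤ K := mul_le_mul hμρ hn2' zero_le_two (by positivity)
  have hKpos : 0 < K := by linarith
  have hsq : √ρ ≤ ρ := Real.sqrt_le_iff.2 ⟨hρ0.le, by nlinarith⟩
  have hsq0 : 0 < √ρ := Real.sqrt_pos.2 hρ0
  have hmu2 : μ * √ρ ≤ 2 * (μ ^ 2 * ρ) := by
    calc μ * √ρ ≤ (2 * μ ^ 2) * ρ :=
          mul_le_mul (by nlinarith) hsq hsq0.le (by positivity)
      _ = _ := by ring
  have hmu6 : ρ + μ * √ρ ≤ 6 * (μ ^ 2 * ρ) := by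
    have : 1 / 4 * ρ ≤ μ ^ 2 * ρ := mul_le_mul_of_nonneg_right hμ2 hρ0.le
    linarith
  -- `N P e e ≤ (ρ + μ √ρ)(a + c) ≤ 6 μ² ρ · 2n = 12 K`, which must be at most `L / 2`.
  set L : ℝ := 24 * K with hL
  have hLpos : 0 < L := by positivity
  set b : ℝ := μ * √ρ / √N with hb
  have hbpos : 0 < b := by positivity
  have hNb2 : N * b ^ 2 = μ ^ 2 * ρ := by
    rw [hb, div_pow, mul_pow, Real.sq_sqrt hρ0.le, Real.sq_sqrt hNpos.le]
    field_simp
  have hUV : ‖vecOf (S.U * S.Vᵀ)‖ ≤ b :=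
    (pi_norm_le_iff_of_nonneg hbpos.le).2 fun e => S.abs_cross_le hρ0 e.1 e.2
  have hκ : ∀ e, N * S.tangentProj e e ≤ L / 2 := by
    intro e
    have t1 := (abs_le.1 (S.abs_left_le hρ0 e.1 e.1)).2
    have t2 := (abs_le.1 (S.abs_right_le hρ0 e.2 e.2)).2
    rw [if_pos rfl] at t1 t2
    have t3 := S.tangentProj_apply_self_le e
    have t4 : (S.U * S.Uᵀ) e.1 e.1 ≤ (ρ + μ * √ρ) / a := by rw [add_div]; linarith
    have t5 : (S.V * S.Vᵀ) e.2 e.2 ≤ (ρ + μ * √ρ) / c := by rw [add_div]; linarith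
    have hw : 0 ≤ ρ + μ * √ρ := by positivity
    calc N * S.tangentProj e e ≤ N * ((ρ + μ * √ρ) / a + (ρ + μ * √ρ) / c) := by
          gcongr; linarith
      _ = (ρ + μ * √ρ) * (a + c) := by rw [hNac]; field_simp; ring
      _ ≤ 6 * (μ ^ 2 * ρ) * (n + n) := by gcongr
      _ = L / 2 := by rw [hL, hK]; ring
  have hNb : N * b ≤ L / 2 := by
    have e : N * b = √N * (μ * √ρ) := by
      rw [hb]
      nth_rw 1 [← Real.mul_self_sqrt hNpos.le]
      have : 0 < √N := Real.sqrt_pos.2 hNpos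
      field_simp
    have hsN : √N ≤ n := Real.sqrt_le_iff.2 ⟨hnpos.le, hNn⟩
    calc N * b ≤ n * (2 * (μ ^ 2 * ρ)) := by rw [e]; gcongr
      _ ≤ L / 2 := by linarith
  have hbα : a * (N * b ^ 2) ≤ L := by
    have := mul_le_mul_of_nonneg_right han (by positivity : 0 ≤ μ ^ 2 * ρ)
    rw [hNb2]
    linarith
  have hbβ : c * (N * b ^ 2) ≤ L := by
    have := mul_le_mul_of_nonneg_right hcn (by positivity : 0 ≤ μ ^ 2 * ρ)
    rw [hNb2]
    linarith
  -- `21504 = 14 · 64 · 24`, so the Bernstein factor `exp (-s / (64 L))` is at most `n⁻¹⁴`.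
  set s : ℕ := ⌈21504 * (K * ℓ)⌉₊ with hs
  -- Enough batches for `4 ^ (-q) < e ^ (-q) ≤ n⁻⁶`, which pays for the crude factor `8 N² b²`.
  set q : ℕ := ⌈6 * ℓ⌉₊ with hq
  have hKℓ : 1 / 4 * 1 * 2 * 0.69 ≤ K * ℓ :=
    mul_le_mul hK2 hℓ1 (by norm_num) hKpos.le
  have hspos : 0 < s := Nat.ceil_pos.2 (by linarith)
  have hqpos : 0 < q := Nat.ceil_pos.2 (by linarith)
  have hs1 : 21504 * (K * ℓ) ≤ s := Nat.le_ceil _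
  have hs2 : (s : ℝ) ≤ 21508 * (K * ℓ) := by
    have := (Nat.ceil_lt_add_one (a := 21504 * (K * ℓ)) (by linarith)).le
    linarith
  have hq1 : 6 * ℓ ≤ q := Nat.le_ceil _
  have hq2 : (q : ℝ) ≤ 8 * ℓ := by
    have := (Nat.ceil_lt_add_one (a := 6 * ℓ) (by linarith)).le
    linarith
  have hℓ4 : 0.2 ≤ ℓ ^ 4 := by
    calc (0.2 : ℝ) ≤ 0.69 ^ 4 := by norm_num
      _ ≤ ℓ ^ 4 := by gcongr
  have hm' : 1000000 * (K * ℓ ^ 6) ≤ m := by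
    rw [hK]; convert hm using 2; ring
  have hK6 : 0.2 * (K * ℓ ^ 2) ≤ K * ℓ ^ 6 := by
    calc 0.2 * (K * ℓ ^ 2) ≤ ℓ ^ 4 * (K * ℓ ^ 2) := by gcongr
      _ = _ := by ring
  -- The scheme consumes order `K ℓ²` samples; the sixth power of the logarithm covers this because
  -- `ℓ` is at least `0.69`.
  have hqs : q * s ≤ m := by
    have : (q : ℝ) * s ≤ m := by
      calc (q : ℝ) * s ≤ (8 * ℓ) * (21508 * (K * ℓ)) := by gcongr
        _ = 172064 * (K * ℓ ^ 2) := by ring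
        _ ≤ 1000000 * (K * ℓ ^ 6) := by
            have : 0 ≤ K * ℓ ^ 2 := by positivity
            linarith
        _ ≤ m := hm'
    exact_mod_cast this
  -- The sample bound together with `m ≤ N ≤ n²` limits `μ² ρ` to at most `n`, so the residual
  -- estimate is polynomial in `n` alone.
  have hKn : K ≤ (n : ℝ) ^ 2 := by
    have h1 : (m : ℝ) ≤ N := Nat.cast_le.2 hmN
    have h2 : (0.4 : ℝ) ≤ ℓ ^ 2 := by
      calc (0.4 : ℝ) ≤ 0.69 ^ 2 := by norm_num
        _ ≤ ℓ ^ 2 := by gcongr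
    have h3 : K * 0.4 ≤ K * ℓ ^ 2 := by gcongr
    linarith
  have hμn : μ ^ 2 * ρ ≤ n := by
    rw [hK, sq (n : ℝ)] at hKn
    exact le_of_mul_le_mul_right hKn hnpos
  have hsmall : (1 / 4) ^ q * (N * b ^ 2) * (8 * N) < 1 := by
    have h1 : (n : ℝ) ^ 6 ≤ Real.exp 1 ^ q := by
      rw [← hexpℓ 6, ← Real.exp_nat_mul, mul_one]
      exact Real.exp_le_exp.2 (by exact_mod_cast hq1)
    have h2 : Real.exp 1 ^ q < 4 ^ q :=
      pow_lt_pow_left₀ (by linarith [Real.exp_one_lt_d9]) (Real.exp_pos _).le hqpos.ne'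
    have h3 : (8 : ℝ) ≤ (n : ℝ) ^ 3 := by
      calc (8 : ℝ) = 2 ^ 3 := by norm_num
        _ ≤ _ := by gcongr
    have h4 : (N * b ^ 2) * (8 * N) ≤ (n : ℝ) ^ 6 := by
      calc (N * b ^ 2) * (8 * N) ≤ n * ((n : ℝ) ^ 3 * (n : ℝ) ^ 2) := by
            rw [hNb2]; gcongr
        _ = _ := by ring
    rw [mul_assoc, one_div, inv_pow, inv_mul_lt_iff₀ (by positivity), mul_one]
    linarith
  set ι := Fin q × Fin s
  have hι : Fintype.card ι = q * s := by simp [ι]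
  have hrep := card_bad_mul_le (ι := ι) (bad := fun Ω => ¬ IsUniqueCompletion M Ω)
    (fun A B hAB hB hA => hB (hA.mono hAB)) (hι ▸ hqs) hmN
  have hgolf := S.card_not_seqGood_golf_le hLpos hbpos hκ hNb hbα hbβ hspos q
  have hcurry : (({ω : ι → α × β | ¬ IsUniqueCompletion M (Finset.univ.image ω)} :
        Finset (ι → α × β)).card)
      ≤ ({ω : Fin q → Fin s → α × β | ¬ SeqGood (GolfGood S.tangentProj b)
        (golfNext S.tangentProj) q (vecOf (S.U * S.Vᵀ)) ω} :
        Finset (Fin q → Fin s → α × β)).card := by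
    refine Finset.card_le_card_of_injOn Function.curry (fun ω hω => ?_)
      (Function.curry_injective.injOn)
    simp only [Finset.coe_filter, Finset.mem_univ, true_and, Set.mem_ofPred_eq] at hω ⊢
    intro hcon
    refine hω fun X hX hne => ?_
    exact S.nuclearNorm_lt_of_seqGood hbpos hspos hqpos hUV hsmall _ hcon
      (fun j i => hX _ (Finset.mem_image_of_mem ω (Finset.mem_univ (j, i)))) hne
  have hfail : q * ((4 * N + 2 * (a + c)) * Real.exp (-(s / (64 * L)))) ≤ ((n : ℝ) ^ 5)⁻¹ := by
    have h1 : Real.exp (-(s / (64 * L))) ≤ ((n : ℝ) ^ 14)⁻¹ := by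
      rw [← hexpℓ 14, ← Real.exp_neg]
      refine Real.exp_le_exp.2 (neg_le_neg ?_)
      rw [le_div_iff₀ (by positivity), hL]
      push_cast
      linarith
    have h0 : (2 : ℝ) * n ≤ n ^ 2 := by rw [sq]; gcongr
    have h2 : 4 * N + 2 * (a + c) ≤ 8 * (n : ℝ) ^ 2 := by linarith
    have h3 : (q : ℝ) ≤ 8 * n := by linarith
    have h4 : (64 : ℝ) ≤ (n : ℝ) ^ 6 := by
      calc (64 : ℝ) = 2 ^ 6 := by norm_num
        _ ≤ _ := by gcongr
    calc _ ≤ (8 * n) * ((8 * (n : ℝ) ^ 2) * ((n : ℝ) ^ 14)⁻¹) := by gcongr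
      _ = 64 * ((n : ℝ) ^ 11)⁻¹ := by field_simp; norm_num
      _ ≤ (n : ℝ) ^ 6 * ((n : ℝ) ^ 11)⁻¹ := by gcongr
      _ = _ := by field_simp
  have hpow : (0 : ℝ) < (N ^ s) ^ q := by positivity
  have hrep' := (Nat.cast_le (α := ℝ)).2 hrep
  push_cast at hrep'
  rw [hι, mul_comm q s, pow_mul, ← hN] at hrep'
  refine le_of_mul_le_mul_right (hrep'.trans ?_) hpow
  calc _ ≤ (((n : ℝ) ^ 5)⁻¹ * (N ^ s) ^ q)
        * ((Finset.univ : Finset (α × β)).powersetCard m).card := by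
        refine mul_le_mul_of_nonneg_right ?_ (by positivity)
        refine (Nat.cast_le.2 hcurry).trans (hgolf.trans ?_)
        gcongr
    _ = _ := by ring

end MatrixCompletion

/-! ### Completion of tensors -/

section TensorCompletion

/-- Modes of size one can be added to or removed from a multi-index. -/
def relabelModes {κ : Type} {n : κ → ℕ} (hn : ∀ k, 0 < n k) (p p' : κ → Prop) [DecidablePred p]
    [DecidablePred p'] (h : ∀ k, 2 ≤ n k → (p k ↔ p' k)) :
    (∀ k : {k // p k}, Fin (n k)) ≃ (∀ k : {k // p' k}, Fin (n k)) where
  toFun a := fun k => if h : p k then a ⟨k, h⟩ else ⟨0, hn k⟩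
  invFun a := fun k => if h : p' k then a ⟨k, h⟩ else ⟨0, hn k⟩
  left_inv a := by
    funext ⟨k, hk⟩
    by_cases hk' : p' k
    · simp [hk, hk']
    · have : Subsingleton (Fin (n k)) :=
        Fin.subsingleton_iff_le_one.2 (by by_contra hc; exact hk' ((h k (by omega)).1 hk))
      exact Subsingleton.elim (α := Fin (n k)) _ _
  right_inv a := by
    funext ⟨k, hk⟩
    by_cases hk' : p k
    · simp [hk, hk']
    · have : Subsingleton (Fin (n k)) :=
        Fin.subsingleton_iff_le_one.2 (by by_contra hc; exact hk' ((h k (by omega)).2 hk))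
      exact Subsingleton.elim (α := Fin (n k)) _ _

variable {d : ℕ} {n : Fin d → ℕ}

/-- The modes of size at least two among the rows of an unfolding. -/
def essentialArc (n : Fin d → ℕ) (l : ℕ) (i : Fin d) : Finset (Fin d) :=
  {k | 2 ≤ n k ∧ InArc i l k}

/-- A mode of size one carries no information, so moving it between rows and columns only relabels
the matrix. -/
theorem nuclearNorm_unfold_eq (hn : ∀ k, 0 < n k) {i j : Fin d} {l : ℕ}
    (h : essentialArc n l i = essentialArc n l j) (X : RTensor n) :
    nuclearNorm (unfold X i l) = nuclearNorm (unfold X j l) := by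
  have hij : ∀ k, 2 ≤ n k → (InArc j l k ↔ InArc i l k) := fun k hk => by
    have := Finset.ext_iff.1 h k
    simp only [essentialArc, Finset.mem_filter, Finset.mem_univ, true_and, hk] at this
    exact this.symm
  rw [← nuclearNorm_submatrix (unfold X i l) (relabelModes hn (InArc j l) (InArc i l) hij)
    (relabelModes hn (fun k => ¬ InArc j l k) (fun k => ¬ InArc i l k)
      fun k hk => not_congr (hij k hk))]
  congr 1
  ext a b
  simp only [Matrix.submatrix_apply, unfold, Matrix.of_apply]
  congr 1
  funext k
  by_cases hk : 2 ≤ n k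
  · by_cases hi : InArc i l k
    · simp [hi, (hij k hk).2 hi, relabelModes]
    · have hj : ¬ InArc j l k := fun hj => hi ((hij k hk).1 hj)
      simp [hi, hj, relabelModes]
  · have : Subsingleton (Fin (n k)) := Fin.subsingleton_iff_le_one.2 (by omega)
    exact Subsingleton.elim _ _

/-- The correspondence between entries of a tensor and of its unfolding. -/
def unfoldEquiv (n : Fin d → ℕ) (i : Fin d) (l : ℕ) :
    (∀ k, Fin (n k)) ≃ RowIdx n i l × ColIdx n i l :=
  Equiv.piEquivPiSubtypeProd (InArc i l) fun k => Fin (n k)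

theorem unfold_apply_unfoldEquiv (X : RTensor n) (i : Fin d) (l : ℕ) (j : ∀ k, Fin (n k)) :
    unfold X i l (unfoldEquiv n i l j).1 (unfoldEquiv n i l j).2 = X j := by
  change X ((unfoldEquiv n i l).symm (unfoldEquiv n i l j)) = X j
  rw [Equiv.symm_apply_apply]

theorem unfold_injective (i : Fin d) (l : ℕ) :
    Function.Injective fun X : RTensor n => unfold X i l := fun X Y h => by
  funext j
  rw [← unfold_apply_unfoldEquiv X i l, ← unfold_apply_unfoldEquiv Y i l]
  exact congrFun (congrFun h _) _

theorem card_rowIdx (i : Fin d) (l : ℕ) :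
    Fintype.card (RowIdx n i l) = ∏ k with InArc i l k, n k := by
  rw [Fintype.card_pi]
  simp only [Fintype.card_fin]
  exact (Finset.prod_subtype _ (by simp) n).symm

theorem card_colIdx (i : Fin d) (l : ℕ) :
    Fintype.card (ColIdx n i l) = ∏ k with ¬ InArc i l k, n k := by
  rw [Fintype.card_pi]
  simp only [Fintype.card_fin]
  exact (Finset.prod_subtype _ (by simp) n).symm

theorem nbar_eq (n : Fin d → ℕ) (i : Fin d) (l : ℕ) :
    nbar n i l = max (Fintype.card (RowIdx n i l)) (Fintype.card (ColIdx n i l)) := by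
  rw [card_rowIdx, card_colIdx, nbar]

theorem prod_le_nbar_sq (n : Fin d → ℕ) (i : Fin d) (l : ℕ) : ∏ k, n k ≤ nbar n i l ^ 2 := by
  rw [← Finset.prod_filter_mul_prod_filter_not Finset.univ (InArc i l), sq]
  exact Nat.mul_le_mul (le_max_left _ _) (le_max_right _ _)

/-- `T` is the unique minimizer of the nuclear norm of one unfolding, given its entries on `Ω`. -/
def IsUniqueForUnfolding (i : Fin d) (l : ℕ) (T : RTensor n) (Ω : Finset (∀ k, Fin (n k))) : Prop :=
  ∀ X : RTensor n, (∀ j ∈ Ω, X j = T j) → X ≠ T →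
    nuclearNorm (unfold T i l) < nuclearNorm (unfold X i l)

theorem isUniqueSolution_of_forall {w : Fin d → ℝ} {l : ℕ} {T : RTensor n}
    {Ω : Finset (∀ k, Fin (n k))} (hw : ∀ i ∈ shifts d, 0 ≤ w i) (hw' : ∃ i ∈ shifts d, 0 < w i)
    (h : ∀ i ∈ shifts d, IsUniqueForUnfolding i l T Ω) : IsUniqueSolution w l T Ω := by
  intro X hX hne
  obtain ⟨i, hi, hwi⟩ := hw'
  exact Finset.sum_lt_sum
    (fun i hi => mul_le_mul_of_nonneg_left (h i hi X hX hne).le (hw i hi))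
    ⟨i, hi, mul_lt_mul_of_pos_left (h i hi X hX hne) hwi⟩

-- Unfolding is a bijection on entries and so carries the uniform law of `Ω` to that of the matrix
-- samples.
open Classical in
theorem card_not_isUniqueForUnfolding_le (hn : ∀ k, 0 < n k) {T : RTensor n} {i : Fin d} {l m : ℕ}
    (S : CompactSVD (unfold T i l)) {ρ : ℝ} (hρ : 1 ≤ ρ) (hn2 : 2 ≤ nbar n i l)
    (hmN : m ≤ ∏ k, n k)
    (hm : 1000000 * (S.incoherence ρ ^ 2 * nbar n i l * ρ * Real.log (nbar n i l) ^ 6) ≤ m) :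
    ((((Finset.univ : Finset (∀ k, Fin (n k))).powersetCard m).filter
        fun Ω => ¬ IsUniqueForUnfolding i l T Ω).card : ℝ)
      ≤ ((nbar n i l : ℝ) ^ 5)⁻¹
        * ((Finset.univ : Finset (∀ k, Fin (n k))).powersetCard m).card := by
  have : Nonempty (RowIdx n i l) := ⟨fun k => ⟨0, hn k⟩⟩
  have : Nonempty (ColIdx n i l) := ⟨fun k => ⟨0, hn k⟩⟩
  set e := unfoldEquiv n i l with he
  have hcard : Fintype.card (RowIdx n i l × ColIdx n i l) = ∏ k, n k := by
    rw [← Fintype.card_congr e, Fintype.card_pi]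
    simp
  have key := S.card_not_isUniqueCompletion_le hρ (nbar_eq n i l) hn2 (hcard ▸ hmN) hm
  have hpc : ((Finset.univ : Finset (RowIdx n i l × ColIdx n i l)).powersetCard m).card
      = ((Finset.univ : Finset (∀ k, Fin (n k))).powersetCard m).card := by
    rw [Finset.card_powersetCard, Finset.card_powersetCard, Finset.card_univ, Finset.card_univ,
      Fintype.card_congr e]
  rw [hpc] at key
  refine le_trans (Nat.cast_le.2 ?_) key
  refine Finset.card_le_card_of_injOn (fun Ω => Ω.map e.toEmbedding) (fun Ω hΩ => ?_)
    (Finset.map_injective _).injOn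
  simp only [Finset.coe_filter, Finset.mem_powersetCard_univ, Set.mem_ofPred_eq,
    Finset.card_map] at hΩ ⊢
  refine ⟨hΩ.1, fun hcon => hΩ.2 fun X hX hne => ?_⟩
  refine hcon (unfold X i l) (fun p hp => ?_) ((unfold_injective i l).ne hne)
  obtain ⟨j, hj, rfl⟩ := Finset.mem_map.1 hp
  exact (unfold_apply_unfoldEquiv X i l j).trans
    ((hX j hj).trans (unfold_apply_unfoldEquiv T i l j).symm)

/-- The arcs are subsets of the modes of size at least two, and each such mode contributes a factor
at least `2` to the product. This makes the union bound independent of `d`. -/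
theorem card_image_essentialArc_le (n : Fin d → ℕ) (hn : ∀ k, 0 < n k) (l : ℕ)
    (s : Finset (Fin d)) : (s.image (essentialArc n l)).card ≤ ∏ k, n k := by
  have hsub : s.image (essentialArc n l) ⊆ ({k | 2 ≤ n k} : Finset (Fin d)).powerset := by
    intro A hA
    obtain ⟨i, -, rfl⟩ := Finset.mem_image.1 hA
    refine Finset.mem_powerset.2 fun k hk => ?_
    simp only [essentialArc, Finset.mem_filter, Finset.mem_univ, true_and] at hk ⊢
    exact hk.1
  refine (Finset.card_le_card hsub).trans ?_
  rw [Finset.card_powerset]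
  calc 2 ^ ({k | 2 ≤ n k} : Finset (Fin d)).card
      ≤ ∏ k ∈ ({k | 2 ≤ n k} : Finset (Fin d)), n k :=
        Finset.pow_card_le_prod _ _ _ fun k hk => (Finset.mem_filter.1 hk).2
    _ ≤ ∏ k, n k := Finset.prod_le_prod_of_subset_of_one_le' (Finset.subset_univ _)
        fun k _ _ => hn k

open Classical in
/-- Union bound over the finitely many essentially different unfoldings. -/
theorem one_sub_le_recoveryProb (hn : ∀ k, 0 < n k) {T : RTensor n} {l m : ℕ} {w : Fin d → ℝ}
    (hw : ∀ i ∈ shifts d, 0 ≤ w i) (hw' : ∃ i ∈ shifts d, 0 < w i) (hmN : m ≤ ∏ k, n k) {F : ℝ}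
    (hF : ∀ i ∈ shifts d, ((((Finset.univ : Finset (∀ k, Fin (n k))).powersetCard m).filter
        fun Ω => ¬ IsUniqueForUnfolding i l T Ω).card : ℝ)
      ≤ F / (∏ k, n k : ℕ)
        * ((Finset.univ : Finset (∀ k, Fin (n k))).powersetCard m).card) :
    1 - F ≤ recoveryProb w l m T := by
  set A := (Finset.univ : Finset (∀ k, Fin (n k))).powersetCard m with hA
  set bad : Fin d → Finset (Finset (∀ k, Fin (n k))) := fun i =>
    A.filter fun Ω => ¬ IsUniqueForUnfolding i l T Ω with hbad
  have hApos : (0 : ℝ) < A.card := by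
    rw [hA, Finset.card_powersetCard, Finset.card_univ, Fintype.card_pi]
    simpa using Nat.choose_pos hmN
  have hNpos : (0 : ℝ) < (∏ k, n k : ℕ) := by
    exact_mod_cast Finset.prod_pos fun k _ => hn k
  -- The failure event depends on the shift only through its essential arc, so the union runs over
  -- distinct arcs.
  have hfac : Function.FactorsThrough bad (essentialArc n l) := fun i j hij => by
    simp only [hbad]
    refine Finset.filter_congr fun Ω _ => not_congr (forall_congr' fun X => ?_)
    rw [nuclearNorm_unfold_eq hn hij, nuclearNorm_unfold_eq hn hij]
  obtain ⟨g, hg⟩ := (Function.factorsThrough_iff bad).1 hfac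
  set U := ((shifts d).image (essentialArc n l)).biUnion g with hU
  have hUcard : (U.card : ℝ) ≤ F * A.card := by
    obtain ⟨i₀, hi₀, -⟩ := hw'
    have hF0 : 0 ≤ F / (∏ k, n k : ℕ) * A.card := (Nat.cast_nonneg _).trans (hF i₀ hi₀)
    calc (U.card : ℝ) ≤ ((∑ B ∈ (shifts d).image (essentialArc n l), (g B).card : ℕ) : ℝ) :=
          Nat.cast_le.2 Finset.card_biUnion_le
      _ ≤ ∑ B ∈ (shifts d).image (essentialArc n l), F / (∏ k, n k : ℕ) * A.card := by
          rw [Nat.cast_sum]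
          refine Finset.sum_le_sum fun B hB => ?_
          obtain ⟨i, hi, rfl⟩ := Finset.mem_image.1 hB
          have : g (essentialArc n l i) = bad i := (congrFun hg i).symm
          rw [this]
          exact hF i hi
      _ = ((shifts d).image (essentialArc n l)).card * (F / (∏ k, n k : ℕ) * A.card) := by
          rw [Finset.sum_const, nsmul_eq_mul]
      _ ≤ (∏ k, n k : ℕ) * (F / (∏ k, n k : ℕ) * A.card) := by
          refine mul_le_mul_of_nonneg_right ?_ hF0
          exact Nat.cast_le.2 (card_image_essentialArc_le n hn l _)
      _ = F * A.card := by field_simp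
  have hsub : A \ U ⊆ A.filter (IsUniqueSolution w l T) := by
    intro Ω hΩ
    rw [Finset.mem_sdiff] at hΩ
    refine Finset.mem_filter.2 ⟨hΩ.1, isUniqueSolution_of_forall hw hw' fun i hi => ?_⟩
    by_contra hcon
    refine hΩ.2 (Finset.mem_biUnion.2 ⟨_, Finset.mem_image_of_mem _ hi, ?_⟩)
    have : g (essentialArc n l i) = bad i := (congrFun hg i).symm
    rw [this]
    exact Finset.mem_filter.2 ⟨hΩ.1, hcon⟩
  have hcount : (A.card : ℝ) ≤ (A.filter (IsUniqueSolution w l T)).card + U.card := by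
    have h1 := Finset.card_le_card hsub
    have h2 := Finset.le_card_sdiff U A
    exact_mod_cast (by omega : A.card ≤ (A.filter (IsUniqueSolution w l T)).card + U.card)
  rw [recoveryProb, le_div_iff₀ hApos]
  linarith

/-- Exact recovery by weighted nuclear norm minimization, with an explicit constant. -/
theorem one_sub_failureBound_le_recoveryProb [NeZero d] (hn : ∀ k, 0 < n k) {T : RTensor n}
    {l m : ℕ} {w : Fin d → ℝ} (S : ∀ i : Fin d, CompactSVD (unfold T i l)) {ρ : Fin d → ℝ}
    (hρ : ∀ i, 1 ≤ ρ i) (hw : ∀ i ∈ shifts d, 0 ≤ w i) (hw' : ∃ i ∈ shifts d, 0 < w i)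
    (hmN : m ≤ ∏ k, n k)
    (hm : 1000000 * (shifts d).sup' (shifts_nonempty d) (fun i =>
      (S i).incoherence (ρ i) ^ 2 * nbar n i l * ρ i * Real.log (nbar n i l) ^ 6) ≤ m) :
    1 - failureBound n l ≤ recoveryProb w l m T := by
  have hle : ∀ i ∈ shifts d, ((nbar n i l : ℝ) ^ 3)⁻¹ ≤ failureBound n l := fun i hi =>
    Finset.le_sup' (fun i => ((nbar n i l : ℝ) ^ 3)⁻¹) hi
  -- If some `n̄ = 1`, the failure bound is at least one and there is nothing to prove; otherwise
  -- all logarithms are bounded away from zero.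
  by_cases hsmall : ∃ i ∈ shifts d, nbar n i l < 2
  · obtain ⟨i, hi, hlt⟩ := hsmall
    have h1 : 1 ≤ failureBound n l := by
      refine le_trans ?_ (hle i hi)
      have hpos : 0 < nbar n i l :=
        lt_max_of_lt_left (Finset.prod_pos fun k _ => hn k)
      have : nbar n i l = 1 := by omega
      simp [this]
    have h2 : 0 ≤ recoveryProb w l m T := by
      rw [recoveryProb]; positivity
    linarith
  push Not at hsmall
  refine one_sub_le_recoveryProb hn hw hw' hmN fun i hi => ?_
  have h2 := hsmall i hi
  have hm' : 1000000 * ((S i).incoherence (ρ i) ^ 2 * nbar n i l * ρ i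
      * Real.log (nbar n i l) ^ 6) ≤ m := by
    refine le_trans (mul_le_mul_of_nonneg_left ?_ (by norm_num)) hm
    exact Finset.le_sup' (fun i => (S i).incoherence (ρ i) ^ 2 * nbar n i l * ρ i
      * Real.log (nbar n i l) ^ 6) hi
  refine (card_not_isUniqueForUnfolding_le hn (S i) (hρ i) h2 hmN hm').trans ?_
  refine mul_le_mul_of_nonneg_right ?_ (Nat.cast_nonneg _)
  have hNpos : (0 : ℝ) < (∏ k, n k : ℕ) := by
    exact_mod_cast Finset.prod_pos fun k _ => hn k
  have hNle : ((∏ k, n k : ℕ) : ℝ) ≤ (nbar n i l : ℝ) ^ 2 := by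
    exact_mod_cast prod_le_nbar_sq n i l
  have hbpos : (0 : ℝ) < nbar n i l := by exact_mod_cast (by omega : 0 < nbar n i l)
  rw [le_div_iff₀ hNpos]
  calc ((nbar n i l : ℝ) ^ 5)⁻¹ * (∏ k, n k : ℕ)
      ≤ ((nbar n i l : ℝ) ^ 5)⁻¹ * (nbar n i l : ℝ) ^ 2 := by gcongr
    _ = ((nbar n i l : ℝ) ^ 3)⁻¹ := by field_simp
    _ ≤ _ := hle i hi

/-- In the cubical case with `l = ⌈d/2⌉` the rows are the longer side. -/
theorem nbar_const (N : ℕ) (hN : 0 < N) {i : Fin d} :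
    nbar (fun _ : Fin d => N) i ((d + 1) / 2) = N ^ ((d + 1) / 2) := by
  have : NeZero d := ⟨by have := i.2; omega⟩
  have hd : 0 < d := Nat.pos_of_ne_zero (NeZero.ne d)
  have h1 : ({k | InArc i ((d + 1) / 2) k} : Finset (Fin d)).card = (d + 1) / 2 := by
    -- Rotating by `-i` turns the arc into an initial segment.
    rw [← Finset.card_map (Equiv.addRight (-i)).toEmbedding]
    have e : ({k | InArc i ((d + 1) / 2) k} : Finset (Fin d)).map
        (Equiv.addRight (-i)).toEmbedding = ({k | k.val < (d + 1) / 2} : Finset (Fin d)) := by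
      ext k
      simp [InArc, sub_eq_add_neg]
    rw [e, Fin.card_filter_val_lt]
    omega
  have h2 : ({k | ¬ InArc i ((d + 1) / 2) k} : Finset (Fin d)).card = d - (d + 1) / 2 := by
    have := Finset.card_filter_add_card_filter_not (s := (Finset.univ : Finset (Fin d)))
      (InArc i ((d + 1) / 2))
    rw [h1, Finset.card_univ, Fintype.card_fin] at this
    omega
  rw [nbar, Finset.prod_const, Finset.prod_const, h1, h2]
  exact max_eq_left (Nat.pow_le_pow_right hN (by omega))

end TensorCompletion

/-! ### Recovery of tensor ring tensors -/

theorem sq_le_of_le_mul_sqrt {x K c : ℝ} (hc : 0 ≤ c) (hx : 0 ≤ x) (h : x ≤ K * √c) :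
    x ^ 2 ≤ K ^ 2 * c := by
  calc x ^ 2 ≤ (K * √c) ^ 2 := pow_le_pow_left₀ hx h 2
    _ = _ := by rw [mul_pow, Real.sq_sqrt hc]

/-- Exact recovery by weighted nuclear norm minimization from `m` uniformly random entries; the second
part is the (nearly) square unfolding `l = ⌈d/2⌉` of a cubical tensor of rank `[r, …, r]` whose
unfoldings have incoherence of order `√(ln n̄)`. -/
theorem theorem1 :
    (∃ C : ℝ, 0 < C ∧
      ∀ (d : ℕ) [NeZero d] (n r : Fin d → ℕ) (R : TensorRing n r) (μ : Fin d → ℝ)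
        (l : ℕ) (w : Fin d → ℝ) (S : ∀ i : Fin d, CompactSVD (unfold R.eval i l)) (m : ℕ),
        (∀ k, 0 < r k) → SubOrCritical n r → R.StrongIncoherent μ →
        0 < l → l < d →
        (∀ i ∈ shifts d, 0 ≤ w i) → (∃ i ∈ shifts d, 0 < w i) →
        m ≤ ∏ k, n k →
        C * (shifts d).sup' (shifts_nonempty d) (fun i =>
            (S i).incoherence (r i * r (i + Fin.ofNat d l)) ^ 2 * nbar n i l
              * (r i * r (i + Fin.ofNat d l)) * Real.log (nbar n i l) ^ 6) ≤ m →
        1 - failureBound n l ≤ recoveryProb w l m R.eval) ∧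
    (∀ K : ℝ, 0 < K → ∃ C : ℝ, 0 < C ∧
      ∀ (d : ℕ) [NeZero d] (n r : ℕ) (R : TensorRing (fun _ : Fin d => n) (fun _ => r))
        (μ : Fin d → ℝ) (w : Fin d → ℝ)
        (S : ∀ i : Fin d, CompactSVD (unfold R.eval i ((d + 1) / 2))) (m : ℕ),
        2 ≤ d → 0 < r → SubOrCritical (fun _ : Fin d => n) (fun _ => r) → R.StrongIncoherent μ →
        (∀ i ∈ shifts d, 0 ≤ w i) → (∃ i ∈ shifts d, 0 < w i) →
        (∀ i ∈ shifts d, (S i).incoherence (r * r)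
          ≤ K * √(Real.log ((n : ℝ) ^ ((d + 1) / 2)))) →
        m ≤ n ^ d →
        C * ((n : ℝ) ^ ((d + 1) / 2) * (r : ℝ) ^ 2 * Real.log ((n : ℝ) ^ ((d + 1) / 2)) ^ 7) ≤ m →
        1 - ((n : ℝ) ^ ((d + 1) / 2 * 3))⁻¹ ≤ recoveryProb w ((d + 1) / 2) m R.eval) := by
  -- In the cubical case the squared incoherence is at most `K² ln n̄`, which supplies the factor
  -- `K²` and the seventh logarithm.
  refine ⟨⟨1000000, by norm_num, ?_⟩, fun K hK => ⟨1000000 * K ^ 2, by positivity, ?_⟩⟩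
  · intro d _ n r R μ l w S m hr hsub _ _ _ hw hw' hmN hm
    have hn : ∀ k, 0 < n k := fun k => (Nat.mul_pos (hr k) (hr (k + 1))).trans_le (hsub k)
    refine one_sub_failureBound_le_recoveryProb hn S
      (ρ := fun i => (r i : ℝ) * r (i + Fin.ofNat d l)) (fun i => ?_) hw hw' hmN hm
    exact_mod_cast Nat.mul_pos (hr i) (hr (i + Fin.ofNat d l))
  · intro d _ n r R μ w S m _ hr hsub _ hw hw' hinc hmN hm
    have hn : 0 < n := (Nat.mul_pos hr hr).trans_le (hsub 0)
    have hnbar : ∀ i : Fin d, ((nbar (fun _ : Fin d => n) i ((d + 1) / 2) : ℕ) : ℝ)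
        = (n : ℝ) ^ ((d + 1) / 2) := fun i => by
      rw [nbar_const n hn, Nat.cast_pow]
    have hlog : 0 ≤ Real.log ((n : ℝ) ^ ((d + 1) / 2)) :=
      Real.log_nonneg (one_le_pow₀ (by exact_mod_cast hn))
    have hfail : failureBound (fun _ : Fin d => n) ((d + 1) / 2)
        = ((n : ℝ) ^ ((d + 1) / 2 * 3))⁻¹ := by
      simp only [failureBound, hnbar, Finset.sup'_const, pow_mul]
    rw [← hfail]
    refine one_sub_failureBound_le_recoveryProb (fun _ => hn) S
      (ρ := fun _ => (r : ℝ) * r) (fun _ => by exact_mod_cast Nat.mul_pos hr hr) hw hw'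
      (by simpa using hmN) (le_trans ?_ hm)
    rw [mul_assoc]
    refine mul_le_mul_of_nonneg_left (Finset.sup'_le _ _ fun i hi => ?_) (by norm_num)
    rw [hnbar]
    have hsq := sq_le_of_le_mul_sqrt hlog (S i).incoherence_nonneg (hinc i hi)
    calc _ ≤ K ^ 2 * Real.log ((n : ℝ) ^ ((d + 1) / 2)) * (n : ℝ) ^ ((d + 1) / 2)
          * ((r : ℝ) * r) * Real.log ((n : ℝ) ^ ((d + 1) / 2)) ^ 6 := by gcongr
      _ = _ := by ring
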